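/- **Corollary 4.12 (Decoupling Theorem).** Let $M$ be a set, $u:M\to M$ a bijection, and let $X^s,X^c,X^u$ be bundles over $M$ whose fibers $X^s_m,X^c_m,X^u_m$ are complete (nonempty) metric spaces; write $|x-y|$ for distances. Put $X^{cs}_m=X^s_m\times X^c_m$, $X^{cu}_m=X^c_m\times X^u_m$, $X_m=X^s_m\times X^c_m\times X^u_m$, with the maximum metric. A correspondence $H:X_1\times Y_1\to X_2\times Y_2$ (a subset $\mathrm{Graph}\,H$ of $(X_1\times Y_1)\times (X_2\times Y_2)$) has generating map $(F,G)$, $H\sim(F,G)$, where $F:X_1\times Y_2\to X_2$, $G:X_1\times Y_2\to Y_1$, if $(x_2,y_2)\in H(x_1,y_1)\Leftrightarrow y_1=G(x_1,y_2),\ x_2=F(x_1,y_2)$. It satisfies (A)$(\alpha,\lambda_u)$ (B)$(\beta,\lambda_s)$ if for all $(x_2,y_2)\in H(x_1,y_1)$ and $(x_2',y_2')\in H(x_1',y_1')$: (A) $|x_1-x_1'|\le\alpha|y_1-y_1'|$ implies $|x_2-x_2'|\le\alpha|y_2-y_2'|$ and $|y_1-y_1'|\le\lambda_u|y_2-y_2'|$;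 (B) $|y_2-y_2'|\le\beta|x_2-x_2'|$ implies $|y_1-y_1'|\le\beta|x_1-x_1'|$ and $|x_2-x_2'|\le\lambda_s|x_1-x_1'|$. For every $m\in M$ let $H_m:X_m\to X_{u(m)}$ be a correspondence with generating maps $(F^{cs}_m,G^{cs}_m)$, with respect to the splitting $X=X^{cs}\times X^u$, and $(F^{cu}_m,G^{cu}_m)$, with respect to $X=X^s\times X^{cu}$. Assume that $H_m\sim(F^{cs}_m,G^{cs}_m)$ satisfies (A)$(\alpha_u(m),\lambda_u(m))$ (B)$(\beta_{cs}(m),\lambda_{cs}(m))$ and that $H_m\sim(F^{cu}_m,G^{cu}_m)$ satisfies (A)$(\alpha_{cu}(m),\lambda_{cu}(m))$ (B)$(\beta_s(m),\lambda_s(m))$, where all eight functions $M\to[0,\infty)$ are bounded, and * $\sup_m\alpha_u(m)\beta_{cs}(u(m))<1$, $\sup_m\alpha_{cu}(m)\beta_s(u(m))<1$; $\alpha_\kappa(m)\le\alpha_\kappa(u(m))$ for $\kappa=u,cu$ and $\beta_\kappa(u(m))\le\beta_\kappa(m)$ for $\kappa=s,cs$, for all $m$; * $\alpha_{cu}\le1$,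 $\beta_{cs}\le1$, $\beta_{cs}\le\beta_s$, $\alpha_{cu}\le\alpha_u$, $\sup_m\alpha_u(m)\beta_s(m)<1$; * $\sup_m\lambda_u(m)\lambda_{cs}(m)<1$, $\sup_m\lambda_u(m)<1$, $\sup_m\lambda_{cu}(m)\lambda_s(m)<1$, $\sup_m\lambda_s(m)<1$. Let $i=(i_s,i_c,i_u)$ be a $1$-pseudo-invariant section of $H$: with $i_{cs}=(i_s,i_c)$ there is $\eta:M\to[0,\infty)$ such that $\eta(u(m))=\eta(m)$, $$|i_{cs}(u(m))-F^{cs}_m(i_{cs}(m),i_u(u(m)))|\le\eta(u(m)),\qquad |i_u(m)-G^{cs}_m(i_{cs}(m),i_u(u(m)))|\le\eta(m)$$ for all $m$. Finally assume that $H$ is invertible, i.e. every $H_m$ is (the graph of) a bijection $X_m\to X_{u(m)}$. Then there are bundle maps over $u$, with fiber maps $h^s_m:X^{cs}_m\to X^s_{u(m)}$, $h^c_m:X^c_m\to X^c_{u(m)}$, $h^u_m:X^{cu}_m\to X^u_{u(m)}$, and an invertible bundle map $\Pi:X\to X$ over $\mathrm{id}$ (every $\Pi_m:X_m\to X_m$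 is a bijection) such that $\Pi\circ H=(h^s\times h^c\times h^u)\circ\Pi$, i.e. for all $m\in M$ and $z\in X_m$, writing $\Pi_m(z)=(x^s,x^c,x^u)$, $$\Pi_{u(m)}(H_m(z))=\big(h^s_m(x^s,x^c),\,h^c_m(x^c),\,h^u_m(x^c,x^u)\big).$$ Moreover $h^c$ is the center map of $H$: each $h^c_m$ is a bijection with $\mathrm{Lip}\,h^c_m\le\lambda_{cs}(m)$ and $\mathrm{Lip}\,(h^c_m)^{-1}\le\lambda_{cu}(m)$, and it represents $H|_{W^c}$ in the following sense. Let $\hat\varepsilon_1,\hat\varepsilon_2:M\to[1,\infty)$ be any functions with $\hat\varepsilon_1\ge\lambda_{cs}+\varsigma$, $\hat\varepsilon_2\ge\lambda_{cu}+\varsigma$ for some constant $\varsigma>0$, and $\sup_m\lambda_u(m)\hat\varepsilon_1(m)<1$, $\sup_m\lambda_s(m)\hat\varepsilon_2(m)<1$. Put $\hat\varepsilon_1^{(k)}(m)=\prod_{j<k}\hat\varepsilon_1(u^j(m))$, $\hat\varepsilon_2^{(k)}(m)=\prod_{j<k}\hat\varepsilon_2(u^{-j}(m))$. Let $W^{cs}_m$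 be the set of $z\in X_m$ that have a forward orbit $(z_k)_{k\ge0}$ of $H$ with $z_0=z$ and $\sup_{k\ge0}\hat\varepsilon_1^{(k)}(m)^{-1}|z_k-i(u^k(m))|<\infty$, let $W^{cu}_m$ be the set of $z\in X_m$ that have a backward orbit $(z_{-k})_{k\ge0}$ of $H$ with $z_0=z$ and $\sup_{k\ge0}\hat\varepsilon_2^{(k)}(m)^{-1}|z_{-k}-i(u^{-k}(m))|<\infty$, and $W^c_m=W^{cs}_m\cap W^{cu}_m$. Then the projection $P^c_m:X_m\to X^c_m$ maps $W^c_m$ bijectively onto $X^c_m$, $z\in W^c_m$ if and only if $H_m(z)\in W^c_{u(m)}$, and $P^c_{u(m)}H_m(z)=h^c_m(P^c_m z)$ for $z\in W^c_m$. -/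

import Mathlib

open scoped NNReal

namespace Trichotomy

/-! A bundle with metric fibers over `M` is given by its fibers `X : M → Type*`, each of which is a
(nonempty, complete) metric space; a bundle map over `u : M → M` is the family of its fiber maps
`X m → Y (u m)`; a bundle correspondence over `u` is a family of relations between `X m` and
`X (u m)`. Products of fibers carry the maximum metric. -/

section Correspondences

variable {X₁ Y₁ X₂ Y₂ : Type*}

/-- `H ∼ (F, G)`: the correspondence `H : X₁ × Y₁ → X₂ × Y₂` has the generating map `(F, G)`. -/
def HasGeneratingMap (H : SetRel (X₁ × Y₁) (X₂ × Y₂)) (F : X₁ → Y₂ → X₂) (G : X₁ → Y₂ → Y₁) :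
    Prop :=
  ∀ x₁ y₁ x₂ y₂, ((x₁, y₁), (x₂, y₂)) ∈ H ↔ y₁ = G x₁ y₂ ∧ x₂ = F x₁ y₂

/-- The (A)`(α, lamU)` (B)`(β, lamS)` condition for a correspondence `H : X₁ × Y₁ → X₂ × Y₂`. -/
structure ABCondition [MetricSpace X₁] [MetricSpace Y₁] [MetricSpace X₂] [MetricSpace Y₂]
    (H : SetRel (X₁ × Y₁) (X₂ × Y₂)) (α lamU β lamS : ℝ≥0) : Prop where
  A1 : ∀ z z' : X₁ × Y₁, ∀ w w' : X₂ × Y₂, (z, w) ∈ H → (z', w') ∈ H →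
    dist z.1 z'.1 ≤ α * dist z.2 z'.2 → dist w.1 w'.1 ≤ α * dist w.2 w'.2
  A2 : ∀ z z' : X₁ × Y₁, ∀ w w' : X₂ × Y₂, (z, w) ∈ H → (z', w') ∈ H →
    dist z.1 z'.1 ≤ α * dist z.2 z'.2 → dist z.2 z'.2 ≤ lamU * dist w.2 w'.2
  B1 : ∀ z z' : X₁ × Y₁, ∀ w w' : X₂ × Y₂, (z, w) ∈ H → (z', w') ∈ H →
    dist w.2 w'.2 ≤ β * dist w.1 w'.1 → dist z.2 z'.2 ≤ β * dist z.1 z'.1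
  B2 : ∀ z z' : X₁ × Y₁, ∀ w w' : X₂ × Y₂, (z, w) ∈ H → (z', w') ∈ H →
    dist w.2 w'.2 ≤ β * dist w.1 w'.1 → dist w.1 w'.1 ≤ lamS * dist z.1 z'.1

/-- The correspondence `H` is (the graph of) an invertible map. -/
def IsInvertibleMap {A B : Type*} (H : SetRel A B) : Prop :=
  ∃ e : A ≃ B, ∀ a b, (a, b) ∈ H ↔ e a = b

/-- A correspondence `X^s × X^c × X^u → X^s × X^c × X^u`, read as a correspondence
`X^{cs} × X^u → X^{cs} × X^u`, where `X^{cs} = X^s × X^c`. -/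
def regroupCS {S C U S' C' U' : Type*} (H : SetRel (S × C × U) (S' × C' × U')) :
    SetRel ((S × C) × U) ((S' × C') × U') :=
  {p | (Equiv.prodAssoc S C U p.1, Equiv.prodAssoc S' C' U' p.2) ∈ H}

end Correspondences

/-- `sup_m f(m) < 1`. -/
def SupLtOne {M : Type*} (f : M → ℝ≥0) : Prop :=
  ∃ c : ℝ≥0, c < 1 ∧ ∀ m, f m ≤ c

/-- For `H ∼ (F, G) : X × Y → X × Y` over `u`: the section `i = (iX, iY)` is an
`ε`-pseudo-invariant section of `H`. -/
def IsPseudoInvariantSection {M : Type*} {X Y : M → Type*} [∀ m, MetricSpace (X m)]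
    [∀ m, MetricSpace (Y m)] (u : M → M) (F : ∀ m, X m → Y (u m) → X (u m))
    (G : ∀ m, X m → Y (u m) → Y m) (ε : M → ℝ≥0) (iX : ∀ m, X m) (iY : ∀ m, Y m) : Prop :=
  ∃ η : M → ℝ≥0,
    (∀ m, dist (iX (u m)) (F m (iX m) (iY (u m))) ≤ η (u m)) ∧
    (∀ m, dist (iY m) (G m (iX m) (iY (u m))) ≤ η m) ∧
    (∀ m, η (u m) ≤ ε m * η m) ∧
    (∀ m, η m ≤ ε m * η (u m))

/-- The functions appearing in the two (A) (B) conditions. -/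
structure Rates (M : Type*) where
  αu : M → ℝ≥0
  lamU : M → ℝ≥0
  βcs : M → ℝ≥0
  lamCS : M → ℝ≥0
  αcu : M → ℝ≥0
  lamCU : M → ℝ≥0
  βs : M → ℝ≥0
  lamS : M → ℝ≥0

/-- Boundedness of the functions, the two angle conditions and the spectral condition. -/
structure Rates.Admissible {M : Type*} (u : M → M) (R : Rates M) : Prop where
  bdd : ∃ B : ℝ≥0, ∀ m, R.αu m ≤ B ∧ R.lamU m ≤ B ∧ R.βcs m ≤ B ∧ R.lamCS m ≤ B ∧
    R.αcu m ≤ B ∧ R.lamCU m ≤ B ∧ R.βs m ≤ B ∧ R.lamS m ≤ B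
  angle_u_cs : SupLtOne fun m => R.αu m * R.βcs (u m)
  angle_cu_s : SupLtOne fun m => R.αcu m * R.βs (u m)
  αu_mono : ∀ m, R.αu m ≤ R.αu (u m)
  αcu_mono : ∀ m, R.αcu m ≤ R.αcu (u m)
  βs_anti : ∀ m, R.βs (u m) ≤ R.βs m
  βcs_anti : ∀ m, R.βcs (u m) ≤ R.βcs m
  αcu_le_one : ∀ m, R.αcu m ≤ 1
  βcs_le_one : ∀ m, R.βcs m ≤ 1
  βcs_le_βs : ∀ m, R.βcs m ≤ R.βs m
  αcu_le_αu : ∀ m, R.αcu m ≤ R.αu m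
  angle_u_s : SupLtOne fun m => R.αu m * R.βs m
  spectral_u_cs : SupLtOne fun m => R.lamU m * R.lamCS m
  spectral_u : SupLtOne R.lamU
  spectral_cu_s : SupLtOne fun m => R.lamCU m * R.lamS m
  spectral_s : SupLtOne R.lamS

/-- The fibers of the product bundle `X^s × X^c × X^u`. -/
abbrev Triple {M : Type*} (Xs Xc Xu : M → Type*) (m : M) : Type _ := Xs m × Xc m × Xu m

/-- Hyperbolic trichotomy: `H : X^s × X^c × X^u → X^s × X^c × X^u` is a bundle correspondence over
`u` with the generating bundle maps `(Fcs, Gcs)` and `(Fcu, Gcu)`, where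
`H ∼ (Fcs, Gcs)` satisfies (A)`(α_u, λ_u)` (B)`(β_cs, λ_cs)` and
`H ∼ (Fcu, Gcu)` satisfies (A)`(α_cu, λ_cu)` (B)`(β_s, λ_s)`. -/
structure HyperbolicTrichotomy {M : Type*} {Xs Xc Xu : M → Type*}
    [∀ m, MetricSpace (Xs m)] [∀ m, MetricSpace (Xc m)] [∀ m, MetricSpace (Xu m)]
    (u : M → M)
    (H : ∀ m, SetRel (Triple Xs Xc Xu m) (Triple Xs Xc Xu (u m)))
    (Fcs : ∀ m, Xs m × Xc m → Xu (u m) → Xs (u m) × Xc (u m))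
    (Gcs : ∀ m, Xs m × Xc m → Xu (u m) → Xu m)
    (Fcu : ∀ m, Xs m → Xc (u m) × Xu (u m) → Xs (u m))
    (Gcu : ∀ m, Xs m → Xc (u m) × Xu (u m) → Xc m × Xu m)
    (R : Rates M) : Prop where
  gen_cs : ∀ m, HasGeneratingMap (regroupCS (H m)) (Fcs m) (Gcs m)
  gen_cu : ∀ m, HasGeneratingMap (H m) (Fcu m) (Gcu m)
  ab_cs : ∀ m, ABCondition (regroupCS (H m)) (R.αu m) (R.lamU m) (R.βcs m) (R.lamCS m)
  ab_cu : ∀ m, ABCondition (H m) (R.αcu m) (R.lamCU m) (R.βs m) (R.lamS m)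
  rates : R.Admissible u

section Orbits

variable {M : Type*} {X : M → Type*}

/-- `ε^{(k)}(m) = ε(u^{k-1}(m)) ⋯ ε(u(m)) ε(m)`, for a function `ε` over `u`. -/
def cocycle (u : M → M) (ε : M → ℝ≥0) (k : ℕ) (m : M) : ℝ≥0 :=
  ∏ j ∈ Finset.range k, ε (u^[j] m)

/-- The correspondence of the total space that is given by a bundle correspondence over `u`. -/
def totalRel (u : M → M) (H : ∀ m, SetRel (X m) (X (u m))) : SetRel (Σ m, X m) (Σ m, X m) :=
  {p | ∃ m, ∃ z : X m, ∃ w : X (u m), (z, w) ∈ H m ∧ p = (⟨m, z⟩, ⟨u m, w⟩)}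

variable [∀ m, MetricSpace (X m)]

/-- The points of `X_m` that have a forward orbit `(z_k)` of `H` with
`sup_k ε^{(k)}(m)⁻¹ |z_k - i(u^k(m))| < ∞`. -/
def forwardSet (u : M ≃ M) (H : ∀ m, SetRel (X m) (X (u m))) (i : ∀ m, X m) (ε : M → ℝ≥0)
    (m : M) : Set (X m) :=
  {z | ∃ ζ : ℕ → Σ m, X m, ζ 0 = ⟨m, z⟩ ∧ (∀ k, (ζ k, ζ (k + 1)) ∈ totalRel u H) ∧
    ∃ C : ℝ, ∀ k, dist (ζ k).2 (i (ζ k).1) ≤ C * cocycle u ε k m}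

/-- The points of `X_m` that have a backward orbit `(z_{-k})` of `H` with
`sup_k ε^{(k)}(m)⁻¹ |z_{-k} - i(u^{-k}(m))| < ∞`, where `ε` is a function over `u⁻¹`. -/
def backwardSet (u : M ≃ M) (H : ∀ m, SetRel (X m) (X (u m))) (i : ∀ m, X m) (ε : M → ℝ≥0)
    (m : M) : Set (X m) :=
  {z | ∃ ζ : ℕ → Σ m, X m, ζ 0 = ⟨m, z⟩ ∧ (∀ k, (ζ (k + 1), ζ k) ∈ totalRel u H) ∧
    ∃ C : ℝ, ∀ k, dist (ζ k).2 (i (ζ k).1) ≤ C * cocycle u.symm ε k m}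

/-- `ε ≥ 1` lies between `lo` and `1 / hi`, uniformly in `m`. -/
structure IsGrowthFunction (lo hi ε : M → ℝ≥0) : Prop where
  one_le : ∀ m, 1 ≤ ε m
  lower : ∃ ς : ℝ≥0, 0 < ς ∧ ∀ m, lo m + ς ≤ ε m
  upper : SupLtOne fun m => hi m * ε m

/-- `W^c_m = W^{cs}_m ∩ W^{cu}_m`, the center-stable and the center-unstable set being described
by the growth functions `ε₁` (over `u`) and `ε₂` (over `u⁻¹`). -/
def centerSet (u : M ≃ M) (H : ∀ m, SetRel (X m) (X (u m))) (i : ∀ m, X m) (ε₁ ε₂ : M → ℝ≥0)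
    (m : M) : Set (X m) :=
  forwardSet u H i ε₁ m ∩ backwardSet u H i ε₂ m

end Orbits

/-- The bundle map `hc : X^c → X^c` over `u` represents `H : W^c → W^c` through the natural
projection `P^c : W^c → X^c`, which is a bijection in each fiber. -/
structure RepresentsOnCenter {M : Type*} {Xs Xc Xu : M → Type*} (u : M → M)
    (H : ∀ m, SetRel (Triple Xs Xc Xu m) (Triple Xs Xc Xu (u m)))
    (Wc : ∀ m, Set (Triple Xs Xc Xu m)) (hc : ∀ m, Xc m → Xc (u m)) : Prop where
  graph : ∀ m, Set.BijOn (fun z : Triple Xs Xc Xu m => z.2.1) (Wc m) Set.univ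
  invariant : ∀ m, ∀ z w, (z, w) ∈ H m → (z ∈ Wc m ↔ w ∈ Wc (u m))
  comm : ∀ m, ∀ z w, (z, w) ∈ H m → z ∈ Wc m → w.2.1 = hc m z.2.1

end Trichotomy

/-! Since `H` is bijective, every point has one full orbit, and foliations can be defined by growth:
two points share a leaf if the distance of their forward (or backward) orbits grows at most like a
product of rates `ε`. If `ε` lies in the gap between the contraction rate and the inverse of the
expansion rate, this happens exactly when the orbits differ by vectors of the stable cone at all
times (`asymp_iff_inCone`). Hence each leaf is a Lipschitz graph over a whole factor. Existence of
points on it comes from limits of finite boundary value problems (`exists_stable_orbit`), uniqueness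
from expansion in the unstable cone (`eq_of_growth`). Time reversal exchanges the two factors
(`IsSplitting.symm`), so one theory covers both time directions.

Applied to `X^{cs} × X^u` and to `X^s × X^{cu}`, this gives invariant center-stable, stable,
center-unstable and unstable foliations. Shadowing the pseudo-invariant section
(`exists_shadowing_orbit`) singles out one invariant center-stable leaf `W^{cs}` and one invariant
center-unstable leaf `W^{cu}`. The angle conditions make complementary leaves meet in exactly one
point (`existsUnique_mem_inter`) and make `W^{cs} ∩ W^{cu}` a graph over the center
(`existsUnique_mem_center`).

Decoupling is then pure geometry (`FoliationSystem.exists_decoupling`): slide `z` along its unstable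
leaf to `p ∈ W^{cs}`, slide `p` along its stable leaf to `c ∈ W^{cs} ∩ W^{cu}`, and let `b` be the
point where the unstable leaf of `c` meets the center-stable leaf of `z`. Invariance makes `p`, `c`,
`b` commute with the dynamics; `c` is determined by its center component, `p` by `c` and its stable
component, `b` by `c` and its unstable component. -/

namespace Trichotomy

open Filter Topology Finset

/-! ### Cone estimates and boundary value problems along a sequence of correspondences -/

section Sequences

variable {X Y : ℕ → Type*}

/-- `z` is an orbit of `H` on the time interval `[a, b]`. -/
def OrbitOn (H : ∀ k, SetRel (X k × Y k) (X (k + 1) × Y (k + 1))) (a b : ℕ)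
    (z : ∀ k, X k × Y k) : Prop :=
  ∀ k, a ≤ k → k < b → (z k, z (k + 1)) ∈ H k

theorem OrbitOn.mono {H : ∀ k, SetRel (X k × Y k) (X (k + 1) × Y (k + 1))} {a b a' b' : ℕ}
    {z : ∀ k, X k × Y k} (h : OrbitOn H a b z) (ha : a ≤ a') (hb : b' ≤ b) :
    OrbitOn H a' b' z :=
  fun k h1 h2 => h k (ha.trans h1) (h2.trans_le hb)

variable [∀ k, MetricSpace (X k)] [∀ k, MetricSpace (Y k)]

/-- A sequence of correspondences `H k : X k × Y k → X (k + 1) × Y (k + 1)` with generating maps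
that satisfies the (A) (B) condition together with the angle condition. -/
structure SeqDichotomy (H : ∀ k, SetRel (X k × Y k) (X (k + 1) × Y (k + 1)))
    (F : ∀ k, X k → Y (k + 1) → X (k + 1)) (G : ∀ k, X k → Y (k + 1) → Y k)
    (α lu β ls : ℕ → ℝ≥0) (θ : ℝ≥0) : Prop where
  gen : ∀ k, HasGeneratingMap (H k) (F k) (G k)
  ab : ∀ k, ABCondition (H k) (α k) (lu k) (β k) (ls k)
  angle : ∀ k, α k * β (k + 1) ≤ θ
  lt_one : θ < 1
  α_mono : ∀ k, α k ≤ α (k + 1)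
  β_anti : ∀ k, β (k + 1) ≤ β k

variable {H : ∀ k, SetRel (X k × Y k) (X (k + 1) × Y (k + 1))}
  {F : ∀ k, X k → Y (k + 1) → X (k + 1)} {G : ∀ k, X k → Y (k + 1) → Y k}
  {α lu β ls : ℕ → ℝ≥0} {θ : ℝ≥0}

namespace SeqDichotomy

theorem mem (h : SeqDichotomy H F G α lu β ls θ) (k : ℕ) (x : X k) (y : Y (k + 1)) :
    ((x, G k x y), (F k x y, y)) ∈ H k :=
  (h.gen k _ _ _ _).2 ⟨rfl, rfl⟩

/-- Points with equal first components lie in every unstable cone, so (A) controls the dependence on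
`y`; images with equal second components lie in every stable cone, so (B) controls the dependence on
`x`. The next three estimates have the same source. -/
theorem dist_F_right (h : SeqDichotomy H F G α lu β ls θ) (k : ℕ) (x : X k) (y y' : Y (k + 1)) :
    dist (F k x y) (F k x y') ≤ α k * dist y y' :=
  (h.ab k).A1 _ _ _ _ (h.mem k x y) (h.mem k x y') (by simp; positivity)

theorem dist_G_right (h : SeqDichotomy H F G α lu β ls θ) (k : ℕ) (x : X k) (y y' : Y (k + 1)) :
    dist (G k x y) (G k x y') ≤ lu k * dist y y' :=
  (h.ab k).A2 _ _ _ _ (h.mem k x y) (h.mem k x y') (by simp; positivity)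

theorem dist_G_left (h : SeqDichotomy H F G α lu β ls θ) (k : ℕ) (x x' : X k) (y : Y (k + 1)) :
    dist (G k x y) (G k x' y) ≤ β k * dist x x' :=
  (h.ab k).B1 _ _ _ _ (h.mem k x y) (h.mem k x' y) (by simp; positivity)

theorem dist_F_left (h : SeqDichotomy H F G α lu β ls θ) (k : ℕ) (x x' : X k) (y : Y (k + 1)) :
    dist (F k x y) (F k x' y) ≤ ls k * dist x x' :=
  (h.ab k).B2 _ _ _ _ (h.mem k x y) (h.mem k x' y) (by simp; positivity)

theorem dist_F_le (h : SeqDichotomy H F G α lu β ls θ) (k : ℕ) (x x' : X k) (y y' : Y (k + 1)) :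
    dist (F k x y) (F k x' y') ≤ ls k * dist x x' + α k * dist y y' :=
  (dist_triangle _ (F k x' y) _).trans
    (add_le_add (h.dist_F_left k x x' y) (h.dist_F_right k x' y y'))

theorem dist_G_le (h : SeqDichotomy H F G α lu β ls θ) (k : ℕ) (x x' : X k) (y y' : Y (k + 1)) :
    dist (G k x y) (G k x' y') ≤ β k * dist x x' + lu k * dist y y' :=
  (dist_triangle _ (G k x' y) _).trans
    (add_le_add (h.dist_G_left k x x' y) (h.dist_G_right k x' y y'))

/-- The unstable cone is invariant in forward time. -/
theorem cone_u (h : SeqDichotomy H F G α lu β ls θ) {a b : ℕ} {z w : ∀ k, X k × Y k}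
    (hz : OrbitOn H a b z) (hw : OrbitOn H a b w)
    (h0 : dist (z a).1 (w a).1 ≤ α a * dist (z a).2 (w a).2) (hab : a ≤ b) :
    dist (z b).1 (w b).1 ≤ α b * dist (z b).2 (w b).2 := by
  induction b, hab using Nat.le_induction with
  | base => exact h0
  | succ b hab ih =>
    have h1 := ih (hz.mono le_rfl b.le_succ) (hw.mono le_rfl b.le_succ)
    refine ((h.ab b).A1 _ _ _ _ (hz b hab b.lt_succ_self) (hw b hab b.lt_succ_self) h1).trans ?_
    have := h.α_mono b
    gcongr

/-- The constant at time `b + 1` is still `α b`, as (A) provides it before monotonicity weakens it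
to `α (b + 1)`. This is the form that fits the angle condition on `α b * β (b + 1)`. -/
theorem cone_u_succ (h : SeqDichotomy H F G α lu β ls θ) {a b : ℕ} {z w : ∀ k, X k × Y k}
    (hz : OrbitOn H a (b + 1) z) (hw : OrbitOn H a (b + 1) w)
    (h0 : dist (z a).1 (w a).1 ≤ α a * dist (z a).2 (w a).2) (hab : a ≤ b) :
    dist (z (b + 1)).1 (w (b + 1)).1 ≤ α b * dist (z (b + 1)).2 (w (b + 1)).2 :=
  (h.ab b).A1 _ _ _ _ (hz b hab b.lt_succ_self) (hw b hab b.lt_succ_self)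
    (h.cone_u (hz.mono le_rfl b.le_succ) (hw.mono le_rfl b.le_succ) h0 hab)

/-- Orbits in the unstable cone are expanded. -/
theorem expand_u (h : SeqDichotomy H F G α lu β ls θ) {a b : ℕ} {z w : ∀ k, X k × Y k}
    (hz : OrbitOn H a b z) (hw : OrbitOn H a b w)
    (h0 : dist (z a).1 (w a).1 ≤ α a * dist (z a).2 (w a).2) (hab : a ≤ b) :
    dist (z a).2 (w a).2 ≤ (∏ j ∈ Ico a b, (lu j : ℝ)) * dist (z b).2 (w b).2 := by
  induction b, hab using Nat.le_induction with
  | base => simp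
  | succ b hab ih =>
    have hz' := hz.mono le_rfl b.le_succ
    have hw' := hw.mono le_rfl b.le_succ
    refine (ih hz' hw').trans ?_
    rw [prod_Ico_succ_top hab, mul_assoc]
    gcongr
    exact (h.ab b).A2 _ _ _ _ (hz b hab b.lt_succ_self) (hw b hab b.lt_succ_self)
      (h.cone_u hz' hw' h0 hab)

/-- The stable cone is invariant in backward time. -/
theorem cone_s (h : SeqDichotomy H F G α lu β ls θ) {a b : ℕ} {z w : ∀ k, X k × Y k}
    (hz : OrbitOn H a b z) (hw : OrbitOn H a b w)
    (h0 : dist (z b).2 (w b).2 ≤ β b * dist (z b).1 (w b).1) (hab : a ≤ b) :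
    dist (z a).2 (w a).2 ≤ β a * dist (z a).1 (w a).1 := by
  induction b, hab using Nat.le_induction with
  | base => exact h0
  | succ b hab ih =>
    refine ih (hz.mono le_rfl b.le_succ) (hw.mono le_rfl b.le_succ) ?_
    refine (h.ab b).B1 _ _ _ _ (hz b hab b.lt_succ_self) (hw b hab b.lt_succ_self) (h0.trans ?_)
    have := h.β_anti b
    gcongr

theorem contract_s_step (h : SeqDichotomy H F G α lu β ls θ) {a b k : ℕ} {z w : ∀ k, X k × Y k}
    (hz : OrbitOn H a b z) (hw : OrbitOn H a b w)
    (h0 : dist (z b).2 (w b).2 ≤ β b * dist (z b).1 (w b).1) (hak : a ≤ k) (hkb : k < b) :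
    dist (z (k + 1)).1 (w (k + 1)).1 ≤ ls k * dist (z k).1 (w k).1 := by
  refine (h.ab k).B2 _ _ _ _ (hz k hak hkb) (hw k hak hkb) ((h.cone_s (a := k + 1) (b := b)
    (hz.mono (by omega) le_rfl) (hw.mono (by omega) le_rfl) h0 hkb).trans ?_)
  have := h.β_anti k
  gcongr

/-- Orbits in the stable cone are contracted. -/
theorem contract_s (h : SeqDichotomy H F G α lu β ls θ) {a b k : ℕ} {z w : ∀ k, X k × Y k}
    (hz : OrbitOn H a b z) (hw : OrbitOn H a b w)
    (h0 : dist (z b).2 (w b).2 ≤ β b * dist (z b).1 (w b).1) (hak : a ≤ k) (hkb : k ≤ b) :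
    dist (z k).1 (w k).1 ≤ (∏ j ∈ Ico a k, (ls j : ℝ)) * dist (z a).1 (w a).1 := by
  induction k, hak using Nat.le_induction with
  | base => simp
  | succ k hak ih =>
    refine (h.contract_s_step hz hw h0 hak hkb).trans ?_
    rw [prod_Ico_succ_top hak, mul_comm _ (ls k : ℝ), mul_assoc]
    gcongr
    exact ih (by omega)

/-- Boundary value problem for finite orbits. -/
theorem exists_orbitOn [∀ k, CompleteSpace (Y k)] (h : SeqDichotomy H F G α lu β ls θ)
    (i : ∀ k, X k × Y k) {a b : ℕ} (hab : a ≤ b) (x : X a) (y : Y b) :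
    ∃ z, OrbitOn H a b z ∧ (z a).1 = x ∧ (z b).2 = y := by
  induction b, hab using Nat.le_induction with
  | base =>
    refine ⟨Function.update i a (x, y), fun k h1 h2 => by omega, ?_, ?_⟩ <;> simp
  | succ b hab ih =>
    choose z hz hzx hzy using ih
    -- Extending by one step means choosing the second component `y'` at time `b` as a fixed point
    -- of `y' ↦ G b (z y' b).1 y`. Orbits with the same start stay in the unstable cone, so this map
    -- contracts by `α (b - 1) * β b ≤ θ`; for `a = b` it is constant.
    have key : ∀ y₁ y₂ : Y b, dist (G b (z y₁ b).1 y) (G b (z y₂ b).1 y) ≤ θ * dist y₁ y₂ := by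
      intro y₁ y₂
      refine (h.dist_G_left _ _ _ _).trans ?_
      rcases hab.eq_or_lt with rfl | hlt
      · simp only [hzx, dist_self, mul_zero]
        positivity
      · obtain ⟨b, rfl⟩ : ∃ c, b = c + 1 := ⟨b - 1, by omega⟩
        have h1 := h.cone_u_succ (hz y₁) (hz y₂)
          (by simp only [hzx, dist_self]; positivity) (by omega)
        rw [hzy, hzy] at h1
        have h2 : (α b * β (b + 1) : ℝ) ≤ θ := mod_cast h.angle b
        calc (β (b + 1) : ℝ) * dist (z y₁ (b + 1)).1 (z y₂ (b + 1)).1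
            ≤ β (b + 1) * (α b * dist y₁ y₂) := by gcongr
          _ = (α b * β (b + 1)) * dist y₁ y₂ := by ring
          _ ≤ θ * dist y₁ y₂ := by gcongr
    have hc : ContractingWith θ (fun y' : Y b => G b (z y' b).1 y) :=
      ⟨h.lt_one, LipschitzWith.of_dist_le_mul key⟩
    have : Nonempty (Y b) := ⟨(i b).2⟩
    obtain ⟨y₀, hy₀⟩ : ∃ y₀, G b (z y₀ b).1 y = y₀ := ⟨_, hc.fixedPoint_isFixedPt⟩
    have hne : ∀ k, k ≤ b → Function.update (z y₀) (b + 1) (F b (z y₀ b).1 y, y) k = z y₀ k :=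
      fun k hk => Function.update_of_ne (by omega) _ _
    refine ⟨Function.update (z y₀) (b + 1) (F b (z y₀ b).1 y, y), ?_, ?_, ?_⟩
    · intro k hk1 hk2
      rw [hne k (by omega)]
      rcases (show k ≤ b by omega).eq_or_lt with rfl | hlt
      · rw [Function.update_self]
        refine (h.gen k (z y₀ k).1 (z y₀ k).2 _ _).2 ⟨?_, rfl⟩
        rw [hy₀, hzy]
      · rw [hne _ (by omega)]
        exact hz y₀ k hk1 hlt
    · rw [hne a hab, hzx]
    · rw [Function.update_self]

/-- Two orbits with the same first component at time `0` whose distance grows slower than the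
unstable expansion agree. -/
theorem eq_of_growth (h : SeqDichotomy H F G α lu β ls θ) {z w : ∀ k, X k × Y k}
    (hz : ∀ k, (z k, z (k + 1)) ∈ H k) (hw : ∀ k, (w k, w (k + 1)) ∈ H k)
    (h0 : (z 0).1 = (w 0).1) {g : ℕ → ℝ} {K c C : ℝ} (hc0 : 0 ≤ c) (hc1 : c < 1)
    (hg : ∀ k, (∏ j ∈ range k, (lu j : ℝ)) * g k ≤ K * c ^ k)
    (hd : ∀ k, dist (z k) (w k) ≤ C * g k) (hC : 0 ≤ C) : z 0 = w 0 := by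
  refine Prod.ext h0 (dist_le_zero.1 ?_)
  have hlim : Tendsto (fun k : ℕ => C * (K * c ^ k)) atTop (𝓝 0) := by
    simpa using ((tendsto_pow_atTop_nhds_zero_of_lt_one hc0 hc1).const_mul K).const_mul C
  refine ge_of_tendsto' hlim fun k => ?_
  have h1 := h.expand_u (a := 0) (b := k) (fun j _ _ => hz j) (fun j _ _ => hw j)
    (by rw [h0, dist_self]; positivity) k.zero_le
  rw [← range_eq_Ico] at h1
  calc dist (z 0).2 (w 0).2 ≤ (∏ j ∈ range k, (lu j : ℝ)) * dist (z k).2 (w k).2 := h1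
    _ ≤ (∏ j ∈ range k, (lu j : ℝ)) * (C * g k) := by
        gcongr
        exact (le_max_right _ _).trans (hd k)
    _ = C * ((∏ j ∈ range k, (lu j : ℝ)) * g k) := by ring
    _ ≤ C * (K * c ^ k) := by exact mul_le_mul_of_nonneg_left (hg k) hC

/-- A deviation of size `∏ j < J, ε j` at time `J`, pulled back to time `k` within the unstable
cone, gains the factor `c ^ (J - k)`. This makes the approximations below converge geometrically. -/
theorem prod_mul_prod_le {lu ε : ℕ → ℝ≥0} {c : ℝ≥0} (hc : ∀ k, lu k * ε k ≤ c) {k J : ℕ}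
    (hkJ : k ≤ J) : (∏ j ∈ Ico k J, (lu j : ℝ)) * ∏ j ∈ range J, (ε j : ℝ) ≤
      (∏ j ∈ range k, (ε j : ℝ)) * (c : ℝ) ^ (J - k) := by
  rw [← prod_range_mul_prod_Ico _ hkJ, mul_left_comm, ← prod_mul_distrib]
  gcongr
  calc ∏ j ∈ Ico k J, ((lu j : ℝ) * ε j) ≤ ∏ j ∈ Ico k J, (c : ℝ) :=
        prod_le_prod (fun _ _ => by positivity) (fun j _ => mod_cast hc j)
    _ = (c : ℝ) ^ (J - k) := by simp

/-- Limits of finite orbits with a common first component at time `0`. -/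
theorem exists_limit_orbit [∀ k, CompleteSpace (X k)] [∀ k, CompleteSpace (Y k)]
    (h : SeqDichotomy H F G α lu β ls θ)
    {v : ℕ → ∀ k, X k × Y k} (hv : ∀ J, OrbitOn H 0 J (v J)) {x : X 0} (hx : ∀ J, (v J 0).1 = x)
    {ε : ℕ → ℝ≥0} {c B : ℝ≥0} {K : ℝ} (hc : ∀ k, lu k * ε k ≤ c) (hc1 : c < 1)
    (hB : ∀ k, α k ≤ B) (hK : 0 ≤ K)
    (hd : ∀ J, dist (v J J).2 (v (J + 1) J).2 ≤ K * ∏ j ∈ range J, (ε j : ℝ)) :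
    ∃ z : ∀ k, X k × Y k, (∀ k, (z k, z (k + 1)) ∈ H k) ∧ (z 0).1 = x ∧
      (∀ k, Tendsto (fun J => v J k) atTop (𝓝 (z k))) ∧
      ∀ k, dist (v k k) (z k) ≤ (max 1 B * K / (1 - c)) * ∏ j ∈ range k, (ε j : ℝ) := by
  have hc1' : (c : ℝ) < 1 := mod_cast hc1
  -- Consecutive orbits share their start, hence differ in the unstable cone: the gap of their
  -- second components at time `k + n` is shrunk on the way back to `k`, and dominates the first
  -- components there.
  have hstep : ∀ k n, dist (v (k + n) k) (v (k + n + 1) k) ≤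
      (max 1 B * K * ∏ j ∈ range k, (ε j : ℝ)) * (c : ℝ) ^ n := by
    intro k n
    have o1 := hv (k + n)
    have o2 := (hv (k + n + 1)).mono le_rfl (k + n).le_succ
    have h0 : dist (v (k + n) 0).1 (v (k + n + 1) 0).1 ≤
        α 0 * dist (v (k + n) 0).2 (v (k + n + 1) 0).2 := by
      rw [hx, hx, dist_self]; positivity
    have hcone := h.cone_u (o1.mono le_rfl (k.le_add_right n)) (o2.mono le_rfl (k.le_add_right n))
      h0 k.zero_le
    have hexp := h.expand_u (o1.mono k.zero_le le_rfl) (o2.mono k.zero_le le_rfl)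
      hcone (k.le_add_right n)
    have hy : dist (v (k + n) k).2 (v (k + n + 1) k).2 ≤
        K * ((∏ j ∈ range k, (ε j : ℝ)) * (c : ℝ) ^ n) := by
      calc _ ≤ _ := hexp
        _ ≤ (∏ j ∈ Ico k (k + n), (lu j : ℝ)) * (K * ∏ j ∈ range (k + n), (ε j : ℝ)) := by
            gcongr; exact hd _
        _ = K * ((∏ j ∈ Ico k (k + n), (lu j : ℝ)) * ∏ j ∈ range (k + n), (ε j : ℝ)) := by ring
        _ ≤ _ := by
            refine mul_le_mul_of_nonneg_left ?_ hK
            simpa using prod_mul_prod_le hc (k.le_add_right n)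
    have hxx : dist (v (k + n) k).1 (v (k + n + 1) k).1 ≤
        B * dist (v (k + n) k).2 (v (k + n + 1) k).2 := by
      refine hcone.trans ?_
      have := hB k
      gcongr
    rw [Prod.dist_eq]
    calc max _ _ ≤ max 1 (B : ℝ) * dist (v (k + n) k).2 (v (k + n + 1) k).2 := by
          refine max_le (hxx.trans ?_) ?_
          · gcongr; exact le_max_right _ _
          · exact le_mul_of_one_le_left dist_nonneg (le_max_left _ _)
      _ ≤ max 1 (B : ℝ) * (K * ((∏ j ∈ range k, (ε j : ℝ)) * (c : ℝ) ^ n)) := by gcongr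
      _ = _ := by push_cast; ring
  have hcau : ∀ k, ∃ p, Tendsto (fun n => v (k + n) k) atTop (𝓝 p) := fun k =>
    cauchySeq_tendsto_of_complete (cauchySeq_of_le_geometric _ _ hc1' (hstep k))
  choose z hz' using hcau
  have hz : ∀ k, Tendsto (fun J => v J k) atTop (𝓝 (z k)) := by
    intro k
    rw [← tendsto_add_atTop_iff_nat k]
    simpa [add_comm] using hz' k
  refine ⟨z, fun k => ?_, ?_, hz, fun k => ?_⟩
  · have h1 := hz k
    have h2 := hz (k + 1)
    have h11 : Tendsto (fun J => (v J k).1) atTop (𝓝 (z k).1) := (continuous_fst.tendsto _).comp h1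
    have h12 : Tendsto (fun J => (v J k).2) atTop (𝓝 (z k).2) := (continuous_snd.tendsto _).comp h1
    have h21 : Tendsto (fun J => (v J (k + 1)).1) atTop (𝓝 (z (k + 1)).1) :=
      (continuous_fst.tendsto _).comp h2
    have h22 : Tendsto (fun J => (v J (k + 1)).2) atTop (𝓝 (z (k + 1)).2) :=
      (continuous_snd.tendsto _).comp h2
    have hmem : ∀ᶠ J in atTop, (v J k).2 = G k (v J k).1 (v J (k + 1)).2 ∧
        (v J (k + 1)).1 = F k (v J k).1 (v J (k + 1)).2 := by
      filter_upwards [eventually_gt_atTop k] with J hJ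
      exact (h.gen k _ _ _ _).1 (hv J k k.zero_le hJ)
    have d1 := tendsto_iff_dist_tendsto_zero.1 h11
    have d2 := tendsto_iff_dist_tendsto_zero.1 h22
    refine (h.gen k _ _ _ _).2 ⟨?_, ?_⟩
    · refine tendsto_nhds_unique (h12.congr' (hmem.mono fun J hJ => hJ.1)) ?_
      rw [tendsto_iff_dist_tendsto_zero]
      refine squeeze_zero (fun _ => dist_nonneg) (fun J => h.dist_G_le k _ _ _ _) ?_
      simpa using (d1.const_mul (β k : ℝ)).add (d2.const_mul (lu k : ℝ))
    · refine tendsto_nhds_unique (h21.congr' (hmem.mono fun J hJ => hJ.2)) ?_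
      rw [tendsto_iff_dist_tendsto_zero]
      refine squeeze_zero (fun _ => dist_nonneg) (fun J => h.dist_F_le k _ _ _ _) ?_
      simpa using (d1.const_mul (ls k : ℝ)).add (d2.const_mul (α k : ℝ))
  · have h1 : Tendsto (fun J => (v J 0).1) atTop (𝓝 (z 0).1) :=
      (continuous_fst.tendsto _).comp (hz 0)
    simp only [hx] at h1
    exact tendsto_nhds_unique h1 tendsto_const_nhds
  · have h1 := dist_le_of_le_geometric_of_tendsto₀ _ _ hc1' (hstep k) (hz' k)
    refine h1.trans (le_of_eq ?_)
    ring

/-- Every prescribed first component at time `0` belongs to an orbit that stays in the stable cone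
of a given orbit. -/
theorem exists_stable_orbit [∀ k, CompleteSpace (X k)] [∀ k, CompleteSpace (Y k)]
    (h : SeqDichotomy H F G α lu β ls θ) {w : ∀ k, X k × Y k}
    (hw : ∀ k, (w k, w (k + 1)) ∈ H k) {c B : ℝ≥0} (hc : ∀ k, lu k * ls k ≤ c) (hc1 : c < 1)
    (hα : ∀ k, α k ≤ B) (hβ : ∀ k, β k ≤ B) (x : X 0) :
    ∃ z : ∀ k, X k × Y k, (∀ k, (z k, z (k + 1)) ∈ H k) ∧ (z 0).1 = x ∧
      (∀ k, dist (z k).2 (w k).2 ≤ β k * dist (z k).1 (w k).1) ∧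
      ∀ k, dist (z (k + 1)).1 (w (k + 1)).1 ≤ ls k * dist (z k).1 (w k).1 := by
  -- The approximating orbits agree with `w` in the second component at time `J`, which puts them in
  -- the stable cone of `w` on all of `[0, J]`. The limit is taken with the contraction rate `ls` as
  -- growth rate.
  choose v hv hvx hvy using fun J : ℕ => h.exists_orbitOn w J.zero_le x (w J).2
  have hw' : ∀ a b, OrbitOn H a b w := fun _ _ k _ _ => hw k
  have h0 : ∀ J, dist (v J J).2 (w J).2 ≤ β J * dist (v J J).1 (w J).1 := fun J => by
    rw [hvy, dist_self]; positivity
  have hs : ∀ J k, k ≤ J → dist (v J k).2 (w k).2 ≤ β k * dist (v J k).1 (w k).1 := fun J k hk =>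
    h.cone_s ((hv J).mono k.zero_le le_rfl) (hw' _ _) (h0 J) hk
  obtain ⟨z, hz, hzx, hlim, -⟩ := h.exists_limit_orbit hv hvx hc hc1 hα
    (K := B * dist x (w 0).1) (by positivity) (fun J => by
      rw [hvy, dist_comm]
      refine (hs (J + 1) J J.le_succ).trans ?_
      have h1 := h.contract_s (hv (J + 1)) (hw' _ _) (h0 _) J.zero_le J.le_succ
      rw [hvx, ← range_eq_Ico] at h1
      calc (β J : ℝ) * dist (v (J + 1) J).1 (w J).1
          ≤ B * ((∏ j ∈ range J, (ls j : ℝ)) * dist x (w 0).1) := by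
            have := hβ J
            gcongr
        _ = _ := by ring)
  have h1 : ∀ k, Tendsto (fun J => dist (v J k).1 (w k).1) atTop (𝓝 (dist (z k).1 (w k).1)) :=
    fun k => ((continuous_fst.tendsto _).comp (hlim k)).dist tendsto_const_nhds
  have h2 : ∀ k, Tendsto (fun J => dist (v J k).2 (w k).2) atTop (𝓝 (dist (z k).2 (w k).2)) :=
    fun k => ((continuous_snd.tendsto _).comp (hlim k)).dist tendsto_const_nhds
  refine ⟨z, hz, hzx, fun k => ?_, fun k => ?_⟩
  · refine le_of_tendsto_of_tendsto (h2 k) ((h1 k).const_mul _) ?_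
    filter_upwards [eventually_ge_atTop k] with J hJ using hs J k hJ
  · refine le_of_tendsto_of_tendsto (h1 (k + 1)) ((h1 k).const_mul _) ?_
    filter_upwards [eventually_gt_atTop k] with J hJ using
      h.contract_s_step (hv J) (hw' _ _) (h0 J) k.zero_le hJ

end SeqDichotomy

end Sequences

/-! ### Shadowing a pseudo-orbit by an orbit of slow growth -/

section Shadowing

variable {X Y : ℕ → Type*}

/-- `z` is the orbit on `[a, b]` whose stable component at time `a` and whose unstable component at
time `b` are those of the section `i`. -/
structure IsBoundaryOrbit (H : ∀ k, SetRel (X k × Y k) (X (k + 1) × Y (k + 1)))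
    (i : ∀ k, X k × Y k) (a b : ℕ) (z : ∀ k, X k × Y k) : Prop where
  orbit : OrbitOn H a b z
  left : (z a).1 = (i a).1
  right : (z b).2 = (i b).2

variable [∀ k, MetricSpace (X k)] [∀ k, MetricSpace (Y k)]
  {H : ∀ k, SetRel (X k × Y k) (X (k + 1) × Y (k + 1))}
  {F : ∀ k, X k → Y (k + 1) → X (k + 1)} {G : ∀ k, X k → Y (k + 1) → Y k}
  {α lu β ls : ℕ → ℝ≥0} {θ : ℝ≥0}

namespace SeqDichotomy

/-- The distance of a boundary orbit to the section at an intermediate time, in terms of the errors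
of the boundary orbits on the two subintervals. -/
theorem dist_boundaryOrbit_mid (h : SeqDichotomy H F G α lu β ls θ) {B : ℝ≥0}
    (hα : ∀ k, α k ≤ B) {i z z' z'' : ∀ k, X k × Y k} {a b J : ℕ}
    (hz : IsBoundaryOrbit H i a b z) (hz' : IsBoundaryOrbit H i a J z')
    (hz'' : IsBoundaryOrbit H i J b z'') (haJ : a ≤ J) (hJb : J ≤ b) :
    dist (z J).1 (i J).1 ≤
        (dist (z' J).1 (i J).1 + B * dist (z'' J).2 (i J).2) / (1 - θ) ∧
      dist (z J).2 (i J).2 ≤ dist (z'' J).2 (i J).2 + β J * dist (z J).1 (i J).1 ∧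
      dist (z b).1 (i b).1 ≤ dist (z'' b).1 (i b).1 +
        (∏ j ∈ Ico J b, (ls j : ℝ)) * dist (z J).1 (i J).1 ∧
      dist (z a).2 (i a).2 ≤ dist (z' a).2 (i a).2 +
        (∏ j ∈ Ico a J, (lu j : ℝ)) * dist (z J).2 (i J).2 := by
  have hθ : (0 : ℝ) < 1 - θ := sub_pos.2 (mod_cast h.lt_one)
  have o1 := hz.orbit.mono le_rfl hJb
  have o2 := hz.orbit.mono haJ le_rfl
  have hs : dist (z b).2 (z'' b).2 ≤ β b * dist (z b).1 (z'' b).1 := by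
    rw [hz.right, hz''.right, dist_self]; positivity
  have hu : dist (z a).1 (z' a).1 ≤ α a * dist (z a).2 (z' a).2 := by
    rw [hz.left, hz'.left, dist_self]; positivity
  have s1 := h.cone_s o2 hz''.orbit hs hJb
  rw [hz''.left] at s1
  have s2 := h.contract_s o2 hz''.orbit hs hJb le_rfl
  rw [hz''.left] at s2
  have u2 := h.expand_u o1 hz'.orbit hu haJ
  rw [hz'.right] at u2
  have y1 : dist (z J).2 (i J).2 ≤ dist (z'' J).2 (i J).2 + β J * dist (z J).1 (i J).1 := by
    linarith [dist_triangle (z J).2 (z'' J).2 (i J).2]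
  refine ⟨?_, y1, ?_, ?_⟩
  -- At time `J`, `z` and `z'` differ in the unstable cone and `z` and `z''` in the stable cone.
  -- Inserting one estimate into the other leaves `θ` times the quantity to be bounded, which is
  -- absorbed on the left.
  · rw [le_div_iff₀ hθ]
    rcases haJ.eq_or_lt with rfl | hlt
    · rw [hz.left, dist_self, zero_mul]; positivity
    · obtain ⟨J, rfl⟩ : ∃ c, J = c + 1 := ⟨J - 1, by omega⟩
      have u1 := h.cone_u_succ o1 hz'.orbit hu (by omega)
      rw [hz'.right] at u1
      have h1 : (α J : ℝ) * β (J + 1) ≤ θ := mod_cast h.angle J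
      have h2 : (α J : ℝ) ≤ B := mod_cast hα J
      have h3 := dist_triangle (z (J + 1)).1 (z' (J + 1)).1 (i (J + 1)).1
      have h4 := mul_le_mul_of_nonneg_left y1 (α J).coe_nonneg
      have h5 := mul_le_mul_of_nonneg_right h1
        (dist_nonneg (x := (z (J + 1)).1) (y := (i (J + 1)).1))
      have h6 := mul_le_mul_of_nonneg_right h2
        (dist_nonneg (x := (z'' (J + 1)).2) (y := (i (J + 1)).2))
      linarith
  · linarith [dist_triangle (z b).1 (z'' b).1 (i b).1]
  · linarith [dist_triangle (z a).2 (z' a).2 (i a).2]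

/-- The error of a boundary orbit of length one. -/
theorem dist_boundaryOrbit_one (h : SeqDichotomy H F G α lu β ls θ) {B : ℝ≥0}
    (hα : ∀ k, α k ≤ B) (hβ : ∀ k, β k ≤ B) (hls : ∀ k, ls k ≤ B) (hlu : ∀ k, lu k ≤ B)
    {i z : ∀ k, X k × Y k} {η : ℝ} {k : ℕ}
    (hi : ∃ p q, (p, q) ∈ H k ∧ dist p (i k) ≤ η ∧ dist q (i (k + 1)) ≤ η)
    (hz : IsBoundaryOrbit H i k (k + 1) z) :
    dist (z (k + 1)).1 (i (k + 1)).1 ≤ (2 * B + 1) * η ∧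
      dist (z k).2 (i k).2 ≤ (2 * B + 1) * η := by
  obtain ⟨⟨p₁, p₂⟩, ⟨q₁, q₂⟩, hpq, hp, hq⟩ := hi
  rw [Prod.dist_eq, max_le_iff] at hp hq
  obtain ⟨hp1, hp2⟩ := hp
  obtain ⟨hq1, hq2⟩ := hq
  dsimp only at hp1 hp2 hq1 hq2
  obtain ⟨e1, e2⟩ := (h.gen k _ _ _ _).1 hpq
  obtain ⟨e3, e4⟩ := (h.gen k _ _ _ _).1 (hz.orbit k le_rfl k.lt_succ_self)
  rw [hz.left, hz.right] at e3 e4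
  have hη : 0 ≤ η := dist_nonneg.trans hp1
  have c1 : (α k : ℝ) ≤ B := mod_cast hα k
  have c2 : (β k : ℝ) ≤ B := mod_cast hβ k
  have c3 : (ls k : ℝ) ≤ B := mod_cast hls k
  have c4 : (lu k : ℝ) ≤ B := mod_cast hlu k
  rw [dist_comm] at hp1 hq2
  constructor
  · have h1 := h.dist_F_le k (i k).1 p₁ (i (k + 1)).2 q₂
    have h2 := dist_triangle (z (k + 1)).1 q₁ (i (k + 1)).1
    rw [e4] at h2 ⊢
    rw [← e2] at h1
    have h3 : (ls k : ℝ) * dist (i k).1 p₁ ≤ B * η := by gcongr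
    have h4 : (α k : ℝ) * dist (i (k + 1)).2 q₂ ≤ B * η := by gcongr
    linarith
  · have h1 := h.dist_G_le k (i k).1 p₁ (i (k + 1)).2 q₂
    have h2 := dist_triangle (z k).2 p₂ (i k).2
    rw [e3] at h2 ⊢
    rw [← e1] at h1
    have h3 : (β k : ℝ) * dist (i k).1 p₁ ≤ B * η := by gcongr
    have h4 : (lu k : ℝ) * dist (i (k + 1)).2 q₂ ≤ B * η := by gcongr
    linarith

variable [∀ k, CompleteSpace (Y k)]

theorem exists_boundaryOrbit (h : SeqDichotomy H F G α lu β ls θ) (i : ∀ k, X k × Y k) {a b : ℕ}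
    (hab : a ≤ b) : ∃ z, IsBoundaryOrbit H i a b z :=
  let ⟨z, h1, h2, h3⟩ := h.exists_orbitOn i hab (i a).1 (i b).2
  ⟨z, h1, h2, h3⟩

/-- The errors of the boundary orbits of a given length are uniformly bounded. -/
theorem exists_bound_boundaryOrbit (h : SeqDichotomy H F G α lu β ls θ) {B : ℝ≥0}
    (hα : ∀ k, α k ≤ B) (hβ : ∀ k, β k ≤ B) (hls : ∀ k, ls k ≤ B) (hlu : ∀ k, lu k ≤ B)
    (hlu1 : ∀ k, lu k ≤ 1) {i : ∀ k, X k × Y k} {η : ℝ}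
    (hi : ∀ k, ∃ p q, (p, q) ∈ H k ∧ dist p (i k) ≤ η ∧ dist q (i (k + 1)) ≤ η) (n : ℕ) :
    ∃ C : ℝ, 0 ≤ C ∧ ∀ a z, IsBoundaryOrbit H i a (a + n) z →
      dist (z (a + n)).1 (i (a + n)).1 ≤ C ∧ dist (z a).2 (i a).2 ≤ C := by
  have hη : 0 ≤ η := let ⟨_, _, _, hp, _⟩ := hi 0; dist_nonneg.trans hp
  have hθ : (0 : ℝ) < 1 - θ := sub_pos.2 (mod_cast h.lt_one)
  induction n with
  | zero =>
    refine ⟨0, le_rfl, fun a z hz => ?_⟩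
    have h1 := hz.left
    have h2 : (z a).2 = (i a).2 := hz.right
    change dist (z a).1 (i a).1 ≤ 0 ∧ _
    simp [h1, h2]
  | succ n ih =>
    obtain ⟨C, hC, hbd⟩ := ih
    -- The new bound adds the old one, the error of a single step, and `B` times the bound at the
    -- joint `a + n`; it depends on `n` but not on `a`.
    refine ⟨C + (2 * B + 1) * η + B * ((C + B * ((2 * B + 1) * η)) / (1 - θ)), by positivity,
      fun a z hz => ?_⟩
    obtain ⟨z', hz'⟩ := h.exists_boundaryOrbit i (a.le_add_right n)
    obtain ⟨z'', hz''⟩ := h.exists_boundaryOrbit i (a + n).le_succ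
    obtain ⟨e1, d1⟩ := hbd a z' hz'
    obtain ⟨e2, d2⟩ := h.dist_boundaryOrbit_one hα hβ hls hlu (hi _) hz''
    obtain ⟨m1, m2, m3, m4⟩ :=
      h.dist_boundaryOrbit_mid hα hz hz' hz'' (a.le_add_right n) (a + n).le_succ
    have c2 : (β (a + n) : ℝ) ≤ B := mod_cast hβ _
    have c3 : (ls (a + n) : ℝ) ≤ B := mod_cast hls _
    have r : dist (z (a + n)).1 (i (a + n)).1 ≤ (C + B * ((2 * B + 1) * η)) / (1 - θ) := by
      refine m1.trans ?_
      gcongr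
    have hp : ∏ j ∈ Ico a (a + n), (lu j : ℝ) ≤ 1 :=
      prod_le_one (fun _ _ => by positivity) (fun j _ => mod_cast hlu1 j)
    constructor
    · have hI : Ico (a + n) (a + (n + 1)) = {a + n} := Nat.Ico_succ_singleton _
      rw [hI, prod_singleton] at m3
      have : (ls (a + n) : ℝ) * dist (z (a + n)).1 (i (a + n)).1 ≤
        B * ((C + B * ((2 * B + 1) * η)) / (1 - θ)) := by gcongr
      have e3 : dist (z'' (a + (n + 1))).1 (i (a + (n + 1))).1 ≤ (2 * B + 1) * η := e2
      linarith
    · have h1 := mul_le_of_le_one_left (dist_nonneg (x := (z (a + n)).2) (y := (i (a + n)).2)) hp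
      have : (β (a + n) : ℝ) * dist (z (a + n)).1 (i (a + n)).1 ≤
        B * ((C + B * ((2 * B + 1) * η)) / (1 - θ)) := by gcongr
      linarith

/-- The errors of the boundary orbits on `[0, J]` grow at most like `∏ j < J, ε j`. -/
theorem exists_growth_boundaryOrbit (h : SeqDichotomy H F G α lu β ls θ) {B : ℝ≥0}
    (hα : ∀ k, α k ≤ B) (hβ : ∀ k, β k ≤ B) (hls : ∀ k, ls k ≤ B) (hlu : ∀ k, lu k ≤ B)
    (hlu1 : ∀ k, lu k ≤ 1) {i : ∀ k, X k × Y k} {η : ℝ}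
    (hi : ∀ k, ∃ p q, (p, q) ∈ H k ∧ dist p (i k) ≤ η ∧ dist q (i (k + 1)) ≤ η)
    {ε : ℕ → ℝ≥0} (hε : ∀ k, 1 ≤ ε k) {q : ℝ≥0} (hq : q < 1) (hlsε : ∀ k, ls k ≤ q * ε k) :
    ∃ K : ℝ, 0 ≤ K ∧ ∀ J z, IsBoundaryOrbit H i 0 J z →
      dist (z J).1 (i J).1 ≤ K * ∏ j ∈ range J, (ε j : ℝ) := by
  have hθ : (0 : ℝ) < 1 - θ := sub_pos.2 (mod_cast h.lt_one)
  choose C hC hbd using h.exists_bound_boundaryOrbit hα hβ hls hlu hlu1 hi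
  -- Over a block of length `n` the stable rates fall below `(1 - θ) / 2` times the growth rates;
  -- this beats the loss `1 / (1 - θ)` incurred at each joint and lets the recursion close.
  obtain ⟨n, hn⟩ := exists_pow_lt_of_lt_one (half_pos hθ) (show (q : ℝ) < 1 from mod_cast hq)
  have hn0 : n ≠ 0 := by
    rintro rfl
    have := θ.coe_nonneg
    rw [pow_zero] at hn
    linarith
  have hprod : ∀ J, 1 ≤ ∏ j ∈ range J, (ε j : ℝ) := fun J =>
    Finset.one_le_prod (fun j _ => mod_cast hε j)
  set S := ∑ m ∈ range (n + 1), C m with hS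
  have hCS : ∀ m, m ≤ n → C m ≤ S := fun m hm =>
    single_le_sum (f := C) (fun m _ => hC m) (mem_range.2 (by omega))
  have hS0 : 0 ≤ S := sum_nonneg fun m _ => hC m
  have hSK : S ≤ 2 * (1 + B) * S := by nlinarith [B.coe_nonneg, mul_nonneg B.coe_nonneg hS0]
  -- With `K = 2 * (1 + B) * S`, one block returns at most `S`, `K / 2` and `B * S / 2` times the
  -- new growth factor or less, and these add up to no more than `K`.
  refine ⟨2 * (1 + B) * S, by positivity, fun J => ?_⟩
  induction J using Nat.strong_induction_on with
  | _ b ih =>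
    intro z hz
    rcases lt_or_ge b n with hb | hb
    · have h1 := (hbd b 0 z (by rwa [zero_add])).1
      rw [zero_add] at h1
      have h2 : (2 * (1 + B) * S) * 1 ≤ (2 * (1 + B) * S) * ∏ j ∈ range b, (ε j : ℝ) := by
        gcongr; exact hprod b
      linarith [hCS b hb.le]
    · obtain ⟨J, rfl⟩ : ∃ J, b = J + n := ⟨b - n, by omega⟩
      obtain ⟨z', hz'⟩ := h.exists_boundaryOrbit i J.zero_le
      obtain ⟨z'', hz''⟩ := h.exists_boundaryOrbit i (J.le_add_right n)
      have e1 := ih J (by omega) z' hz'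
      obtain ⟨e2, d2⟩ := hbd n J z'' hz''
      obtain ⟨m1, -, m3, -⟩ :=
        h.dist_boundaryOrbit_mid hα hz hz' hz'' J.zero_le (J.le_add_right n)
      have hP : (∏ j ∈ Ico J (J + n), (ls j : ℝ)) ≤
          (1 - θ) / 2 * ∏ j ∈ Ico J (J + n), (ε j : ℝ) := by
        calc (∏ j ∈ Ico J (J + n), (ls j : ℝ)) ≤ ∏ j ∈ Ico J (J + n), ((q : ℝ) * ε j) :=
              prod_le_prod (fun _ _ => by positivity) (fun j _ => mod_cast hlsε j)
          _ = (q : ℝ) ^ n * ∏ j ∈ Ico J (J + n), (ε j : ℝ) := by simp [prod_mul_distrib]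
          _ ≤ _ := by gcongr
      have hPP := prod_range_mul_prod_Ico (fun j => (ε j : ℝ)) (J.le_add_right n)
      set P := ∏ j ∈ Ico J (J + n), (ε j : ℝ)
      set Q := ∏ j ∈ range J, (ε j : ℝ)
      have hQ1 : 1 ≤ Q := hprod J
      have hP0 : 0 ≤ P := prod_nonneg fun _ _ => by positivity
      have hPQ : P ≤ Q * P := le_mul_of_one_le_left hP0 hQ1
      have hQP1 : 1 ≤ Q * P := hPP ▸ hprod (J + n)
      rw [← hPP]
      have hCn := hCS n le_rfl
      calc dist (z (J + n)).1 (i (J + n)).1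
          ≤ S + (1 - θ) / 2 * P * ((2 * (1 + B) * S * Q + B * S) / (1 - θ)) := by
            refine m3.trans (add_le_add (e2.trans hCn) ?_)
            refine mul_le_mul hP (m1.trans ?_) dist_nonneg (by positivity)
            gcongr
            exact d2.trans hCn
        _ = S + (1 + B) * S * (Q * P) + B * S / 2 * P := by field_simp; ring
        _ ≤ S * (Q * P) + (1 + B) * S * (Q * P) + B * S * (Q * P) := by
            have t1 : S * 1 ≤ S * (Q * P) := by gcongr
            have t2 : B * S / 2 * P ≤ B * S * (Q * P) := by
              gcongr
              have := mul_nonneg B.coe_nonneg hS0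
              linarith
            linarith
        _ = 2 * (1 + B) * S * (Q * P) := by ring

/-- Close to a pseudo-orbit there is an orbit whose distance to it grows at most like
`∏ j < k, ε j`. -/
theorem exists_shadowing_orbit [∀ k, CompleteSpace (X k)]
    (h : SeqDichotomy H F G α lu β ls θ) {B : ℝ≥0}
    (hα : ∀ k, α k ≤ B) (hβ : ∀ k, β k ≤ B) (hls : ∀ k, ls k ≤ B) (hlu : ∀ k, lu k ≤ B)
    {i : ∀ k, X k × Y k} {η : ℝ}
    (hi : ∀ k, ∃ p q, (p, q) ∈ H k ∧ dist p (i k) ≤ η ∧ dist q (i (k + 1)) ≤ η)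
    {ε : ℕ → ℝ≥0} (hε : ∀ k, 1 ≤ ε k) {q : ℝ≥0} (hq : q < 1) (hlsε : ∀ k, ls k ≤ q * ε k)
    {c : ℝ≥0} (hc : ∀ k, lu k * ε k ≤ c) (hc1 : c < 1) :
    ∃ z : ∀ k, X k × Y k, (∀ k, (z k, z (k + 1)) ∈ H k) ∧
      ∃ C : ℝ, ∀ k, dist (z k) (i k) ≤ C * ∏ j ∈ range k, (ε j : ℝ) := by
  have hθ : (0 : ℝ) < 1 - θ := sub_pos.2 (mod_cast h.lt_one)
  have hlu1 : ∀ k, lu k ≤ 1 := fun k =>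
    (le_mul_of_one_le_right zero_le (hε k)).trans ((hc k).trans hc1.le)
  obtain ⟨K, hK, hgrow⟩ := h.exists_growth_boundaryOrbit hα hβ hls hlu hlu1 hi hε hq hlsε
  choose v hv using fun J : ℕ => h.exists_boundaryOrbit i J.zero_le
  have hη : 0 ≤ η := let ⟨_, _, _, hp, _⟩ := hi 0; dist_nonneg.trans hp
  set η' : ℝ := (2 * B + 1) * η with hη'
  have hη'0 : 0 ≤ η' := by positivity
  -- At time `J` the second component of `v J` is that of `i`, so comparing with `v (J + 1)` only
  -- needs the error of `v (J + 1)` at `J`. It is found by splitting `[0, J + 1]` at `J`.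
  obtain ⟨z, hz, -, -, hd⟩ := h.exists_limit_orbit (fun J => (hv J).orbit) (fun J => (hv J).left)
    hc hc1 hα (K := η' + B * ((K + B * η') / (1 - θ))) (by positivity) (fun J => by
      have hQ1 : 1 ≤ ∏ j ∈ range J, (ε j : ℝ) := Finset.one_le_prod (fun j _ => mod_cast hε j)
      obtain ⟨z'', hz''⟩ := h.exists_boundaryOrbit i J.le_succ
      obtain ⟨-, d2⟩ := h.dist_boundaryOrbit_one hα hβ hls hlu (hi _) hz''
      have e1 := hgrow J _ (hv J)
      obtain ⟨m1, m2, -, -⟩ :=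
        h.dist_boundaryOrbit_mid hα (hv (J + 1)) (hv J) hz'' J.zero_le J.le_succ
      rw [(hv J).right, dist_comm]
      set Q := ∏ j ∈ range J, (ε j : ℝ)
      have c2 : (β J : ℝ) ≤ B := mod_cast hβ _
      have hd2 : dist (z'' J).2 (i J).2 ≤ η' * Q :=
        d2.trans (le_mul_of_one_le_right hη'0 hQ1)
      have r : dist (v (J + 1) J).1 (i J).1 ≤ (K + B * η') / (1 - θ) * Q := by
        refine m1.trans ?_
        rw [div_mul_eq_mul_div]
        gcongr
        linarith [mul_le_mul_of_nonneg_left hd2 B.coe_nonneg]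
      have : (β J : ℝ) * dist (v (J + 1) J).1 (i J).1 ≤ B * ((K + B * η') / (1 - θ) * Q) := by
        gcongr
      linarith)
  refine ⟨z, hz, max 1 B * (η' + B * ((K + B * η') / (1 - θ))) / (1 - c) + K, fun k => ?_⟩
  have h1 : dist (v k k) (i k) ≤ K * ∏ j ∈ range k, (ε j : ℝ) := by
    rw [Prod.dist_eq, (hv k).right, dist_self]
    exact max_le (hgrow k _ (hv k)) (by positivity)
  have h2 := hd k
  rw [dist_comm] at h2
  rw [add_mul]
  exact (dist_triangle _ _ _).trans (add_le_add h2 h1)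

end SeqDichotomy

end Shadowing

/-! ### Bundle maps with a splitting, and leaves defined by growth -/

section Bundles

variable {M : Type*} {Z A B : M → Type*}

/-- The forward orbit of a base point. -/
def base (v : M → M) (m : M) : ℕ → M
  | 0 => m
  | k + 1 => v (base v m k)

/-- The forward orbit of a point under a bundle map. -/
def orb (v : M → M) (e : ∀ m, Z m → Z (v m)) (m : M) (z : Z m) : ∀ k, Z (base v m k)
  | 0 => z
  | k + 1 => e _ (orb v e m z k)

/-- A bundle map, read in the splittings `σ m : Z m ≃ A m × B m`, as a correspondence. -/
def splitRel (v : M → M) (e : ∀ m, Z m → Z (v m)) (σ : ∀ m, Z m ≃ A m × B m) (m : M) :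
    SetRel (A m × B m) (A (v m) × B (v m)) :=
  {p | e m ((σ m).symm p.1) = (σ (v m)).symm p.2}

theorem base_eq_iterate (v : M → M) (m : M) (k : ℕ) : base v m k = v^[k] m := by
  induction k with
  | zero => rfl
  | succ k ih => rw [Function.iterate_succ_apply', ← ih]; rfl

theorem base_shift (v : M → M) (m : M) (k : ℕ) : base v (v m) k = base v m (k + 1) := by
  rw [base_eq_iterate, base_eq_iterate, Function.iterate_succ_apply]

/-- The two base points agree only propositionally, so the identity lives in the total space;
carrying a pair of points allows distances to be transported along it. -/
theorem orb_shift (v : M → M) (e : ∀ m, Z m → Z (v m)) (m : M) (z w : Z m) (k : ℕ) :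
    (⟨base v (v m) k, orb v e (v m) (e m z) k, orb v e (v m) (e m w) k⟩ : Σ m, Z m × Z m) =
      ⟨base v m (k + 1), orb v e m z (k + 1), orb v e m w (k + 1)⟩ := by
  induction k with
  | zero => rfl
  | succ k ih =>
    exact congrArg (fun p : Σ m, Z m × Z m => (⟨v p.1, e _ p.2.1, e _ p.2.2⟩ : Σ m, Z m × Z m)) ih

theorem prod_base_succ (v : M → M) (ε : M → ℝ≥0) (m : M) (k : ℕ) :
    ∏ j ∈ range (k + 1), (ε (base v m j) : ℝ) =
      ε m * ∏ j ∈ range k, (ε (base v (v m) j) : ℝ) := by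
  rw [prod_range_succ', mul_comm]
  simp only [base_shift]
  rfl

theorem mem_splitRel (v : M → M) (e : ∀ m, Z m → Z (v m)) (σ : ∀ m, Z m ≃ A m × B m) (m : M)
    (z : Z m) : (σ m z, σ (v m) (e m z)) ∈ splitRel v e σ m := by
  simp [splitRel]

theorem orb_mem (v : M → M) (e : ∀ m, Z m → Z (v m)) (σ : ∀ m, Z m ≃ A m × B m) (m : M) (z : Z m)
    (k : ℕ) : (σ _ (orb v e m z k), σ _ (orb v e m z (k + 1))) ∈ splitRel v e σ (base v m k) :=
  mem_splitRel v e σ _ _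

theorem eq_orb {v : M → M} {e : ∀ m, Z m → Z (v m)} {σ : ∀ m, Z m ≃ A m × B m} {m : M}
    {z : ∀ k, A (base v m k) × B (base v m k)}
    (hz : ∀ k, (z k, z (k + 1)) ∈ splitRel v e σ (base v m k)) (k : ℕ) :
    z k = σ _ (orb v e m ((σ m).symm (z 0)) k) := by
  induction k with
  | zero => exact ((σ m).apply_symm_apply _).symm
  | succ k ih =>
    have h1 : e _ ((σ _).symm (z k)) = (σ _).symm (z (k + 1)) := hz k
    rw [ih, Equiv.symm_apply_apply] at h1
    exact ((σ _).symm_apply_eq.1 h1.symm)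

/-- The inverse of an invertible bundle map over `u`, as a bundle map over `u⁻¹`. -/
def symmMap (u : M ≃ M) (e : ∀ m, Z m ≃ Z (u m)) (m : M) (z : Z m) : Z (u.symm m) :=
  (e (u.symm m)).symm (cast (congrArg Z (u.apply_symm_apply m).symm) z)

theorem apply_symmMap_heq (u : M ≃ M) (e : ∀ m, Z m ≃ Z (u m)) (m : M) (z : Z m) :
    e (u.symm m) (symmMap u e m z) ≍ z := by
  exact (heq_of_eq ((e (u.symm m)).apply_symm_apply _)).trans (cast_heq _ _)

theorem symmMap_apply_heq (u : M ≃ M) (e : ∀ m, Z m ≃ Z (u m)) (m : M) (z : Z m) :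
    symmMap u e (u m) (e m z) ≍ z := by
  -- Replacing `u.symm (u m)` by a variable `n` equal to `m` turns the transport into `rfl`. The
  -- same device recurs wherever the inverse map is used.
  have key : ∀ n (_ : n = m) (x : Z (u n)), x ≍ e m z → (e n).symm x ≍ z := by
    rintro n rfl x hx
    rw [eq_of_heq hx, Equiv.symm_apply_apply]
  exact key _ (u.symm_apply_apply m) _ (cast_heq _ _)

/-- A relation that is invariant under `H⁻¹` is invariant under `H`. -/
theorem rel_apply_iff_of_symmMap (u : M ≃ M) (e : ∀ m, Z m ≃ Z (u m)) {R : ∀ m, Z m → Z m → Prop}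
    (hR : ∀ m z w, R m z w ↔ R (u.symm m) (symmMap u e m z) (symmMap u e m w)) (m : M)
    (z w : Z m) : R m z w ↔ R (u m) (e m z) (e m w) := by
  rw [hR (u m)]
  have key : ∀ n (_ : n = m) (a b : Z n), a ≍ z → b ≍ w → (R m z w ↔ R n a b) := by
    rintro n rfl a b ha hb
    rw [eq_of_heq ha, eq_of_heq hb]
  exact key _ (u.symm_apply_apply m) _ _ (symmMap_apply_heq u e m z) (symmMap_apply_heq u e m w)

variable [∀ m, MetricSpace (Z m)] [∀ m, MetricSpace (A m)] [∀ m, MetricSpace (B m)]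

/-- The distance of the forward orbits of `z` and `w` grows at most like `∏ j < k, ε (v^j m)`. -/
def Asymp (v : M → M) (e : ∀ m, Z m → Z (v m)) (ε : M → ℝ≥0) (m : M) (z w : Z m) : Prop :=
  ∃ C : ℝ, ∀ k, dist (orb v e m z k) (orb v e m w k) ≤ C * ∏ j ∈ range k, (ε (base v m j) : ℝ)

namespace Asymp

variable {v : M → M} {e : ∀ m, Z m → Z (v m)} {ε : M → ℝ≥0} {m : M} {z w p : Z m}

theorem refl (z : Z m) : Asymp v e ε m z z := ⟨0, fun k => by simp⟩

theorem symm (h : Asymp v e ε m z w) : Asymp v e ε m w z :=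
  let ⟨C, hC⟩ := h
  ⟨C, fun k => by rw [dist_comm]; exact hC k⟩

theorem trans (h : Asymp v e ε m z w) (h' : Asymp v e ε m w p) : Asymp v e ε m z p :=
  let ⟨C, hC⟩ := h
  let ⟨C', hC'⟩ := h'
  ⟨C + C', fun k => by
    rw [add_mul]; exact (dist_triangle _ _ _).trans (add_le_add (hC k) (hC' k))⟩

theorem mono {ε' : M → ℝ≥0} (h : Asymp v e ε m z w) (hε : ∀ m, ε m ≤ ε' m) :
    Asymp v e ε' m z w := by
  obtain ⟨C, hC⟩ := h
  refine ⟨max C 0, fun k => (hC k).trans ?_⟩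
  have h1 : ∏ j ∈ range k, (ε (base v m j) : ℝ) ≤ ∏ j ∈ range k, (ε' (base v m j) : ℝ) :=
    prod_le_prod (fun _ _ => by positivity) (fun j _ => mod_cast hε _)
  exact mul_le_mul (le_max_left _ _) h1 (prod_nonneg fun _ _ => by positivity) (le_max_right _ _)

theorem apply_iff (hε : ∀ m, 0 < ε m) :
    Asymp v e ε m z w ↔ Asymp v e ε (v m) (e m z) (e m w) := by
  have hd : ∀ k, dist (orb v e (v m) (e m z) k) (orb v e (v m) (e m w) k) =
      dist (orb v e m z (k + 1)) (orb v e m w (k + 1)) := fun k =>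
    congrArg (fun p : Σ m, Z m × Z m => dist p.2.1 p.2.2) (orb_shift v e m z w k)
  have hm : (0 : ℝ) < ε m := mod_cast hε m
  constructor
  · rintro ⟨C, hC⟩
    refine ⟨C * ε m, fun k => ?_⟩
    rw [hd, mul_assoc, ← prod_base_succ]
    exact hC (k + 1)
  · rintro ⟨C, hC⟩
    -- Time `0` is not seen by the orbits of the images and contributes `dist z w` by itself.
    refine ⟨max (dist z w) (C / ε m), fun k => ?_⟩
    cases k with
    | zero =>
      rw [range_zero, prod_empty, mul_one]
      exact le_max_left _ _
    | succ k =>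
      rw [← hd, prod_base_succ, ← mul_assoc]
      refine (hC k).trans ?_
      gcongr
      rw [← div_le_iff₀ hm]
      exact le_max_right _ _

end Asymp

/-- A bundle map together with a splitting in which it satisfies the (A) (B) condition, the angle
condition and the spectral condition. -/
structure IsSplitting (v : M → M) (e : ∀ m, Z m → Z (v m)) (σ : ∀ m, Z m ≃ A m × B m)
    (α lu β ls : M → ℝ≥0) : Prop where
  dist_eq : ∀ m z w, dist z w = max (dist (σ m z).1 (σ m w).1) (dist (σ m z).2 (σ m w).2)
  gen : ∀ m, ∃ F G, HasGeneratingMap (splitRel v e σ m) F G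
  ab : ∀ m, ABCondition (splitRel v e σ m) (α m) (lu m) (β m) (ls m)
  bdd : ∃ K : ℝ≥0, ∀ m, α m ≤ K ∧ lu m ≤ K ∧ β m ≤ K ∧ ls m ≤ K
  angle : SupLtOne fun m => α m * β (v m)
  α_mono : ∀ m, α m ≤ α (v m)
  β_anti : ∀ m, β (v m) ≤ β m
  spectral : SupLtOne fun m => lu m * ls m

namespace IsSplitting

variable {v : M → M} {e : ∀ m, Z m → Z (v m)} {σ : ∀ m, Z m ≃ A m × B m} {α lu β ls : M → ℝ≥0}

theorem seqDichotomy (h : IsSplitting v e σ α lu β ls) (m : M) :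
    ∃ F G θ, SeqDichotomy (X := fun k => A (base v m k)) (Y := fun k => B (base v m k))
      (fun k => splitRel v e σ (base v m k)) F G (fun k => α (base v m k))
      (fun k => lu (base v m k)) (fun k => β (base v m k)) (fun k => ls (base v m k)) θ := by
  choose F G hFG using h.gen
  obtain ⟨θ, hθ, hα⟩ := h.angle
  exact ⟨fun k => F (base v m k), fun k => G (base v m k), θ, fun k => hFG _, fun k => h.ab _,
    fun k => hα _, hθ, fun k => h.α_mono _, fun k => h.β_anti _⟩

theorem dist_σ (h : IsSplitting v e σ α lu β ls) (m : M) (z w : Z m) :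
    dist z w = dist (σ m z) (σ m w) := h.dist_eq m z w

/-- The forward orbits of `z` and `w` differ by vectors in the stable cones. -/
def InCone (v : M → M) (e : ∀ m, Z m → Z (v m)) (σ : ∀ m, Z m ≃ A m × B m)
    (β ls : M → ℝ≥0) (m : M) (z w : Z m) : Prop :=
  ∀ k, dist (σ _ (orb v e m z k)).2 (σ _ (orb v e m w k)).2 ≤
      β (base v m k) * dist (σ _ (orb v e m z k)).1 (σ _ (orb v e m w k)).1 ∧
    dist (σ _ (orb v e m z (k + 1))).1 (σ _ (orb v e m w (k + 1))).1 ≤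
      ls (base v m k) * dist (σ _ (orb v e m z k)).1 (σ _ (orb v e m w k)).1

theorem exists_inCone [∀ m, CompleteSpace (A m)] [∀ m, CompleteSpace (B m)]
    (h : IsSplitting v e σ α lu β ls) (m : M) (w : Z m) (a : A m) :
    ∃ z, (σ m z).1 = a ∧ InCone v e σ β ls m z w := by
  obtain ⟨F, G, θ, hs⟩ := h.seqDichotomy m
  obtain ⟨c, hc1, hc⟩ := h.spectral
  obtain ⟨K, hK⟩ := h.bdd
  obtain ⟨z, hz, hza, h1, h2⟩ := hs.exists_stable_orbit (w := fun k => σ _ (orb v e m w k))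
    (orb_mem v e σ m w) (fun k => hc _) hc1 (fun k => (hK _).1) (fun k => (hK _).2.2.1) a
  refine ⟨(σ m).symm (z 0), (congrArg Prod.fst ((σ m).apply_symm_apply _)).trans hza, fun k => ?_⟩
  rw [← eq_orb hz, ← eq_orb hz]
  exact ⟨h1 k, h2 k⟩

theorem InCone.dist_le (h : IsSplitting v e σ α lu β ls) {m : M} {z w : Z m}
    (hzw : InCone v e σ β ls m z w) : ∃ C : ℝ, 0 ≤ C ∧ ∀ k,
      dist (orb v e m z k) (orb v e m w k) ≤ C * ∏ j ∈ range k, (ls (base v m j) : ℝ) := by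
  obtain ⟨K, hK⟩ := h.bdd
  have h1 : ∀ k, dist (σ _ (orb v e m z k)).1 (σ _ (orb v e m w k)).1 ≤
      (∏ j ∈ range k, (ls (base v m j) : ℝ)) * dist (σ m z).1 (σ m w).1 := by
    intro k
    induction k with
    | zero => simp [orb]; rfl
    | succ k ih =>
      refine (hzw k).2.trans ?_
      rw [prod_range_succ, mul_comm _ (ls _ : ℝ), mul_assoc]
      gcongr
  refine ⟨max 1 K * dist (σ m z).1 (σ m w).1, by positivity, fun k => ?_⟩
  rw [h.dist_eq]
  have h2 := (hzw k).1
  have h3 : (β (base v m k) : ℝ) ≤ K := mod_cast (hK _).2.2.1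
  calc max _ _ ≤ max 1 (K : ℝ) * dist (σ _ (orb v e m z k)).1 (σ _ (orb v e m w k)).1 := by
        refine max_le (le_mul_of_one_le_left dist_nonneg (le_max_left _ _)) (h2.trans ?_)
        gcongr
        exact h3.trans (le_max_right _ _)
    _ ≤ max 1 (K : ℝ) * ((∏ j ∈ range k, (ls (base v m j) : ℝ)) * dist (σ m z).1 (σ m w).1) := by
        gcongr
        exact h1 k
    _ = _ := by push_cast; ring

/-- Orbits whose distance grows slowly differ by vectors in the stable cones. -/
theorem inCone_of_growth [∀ m, CompleteSpace (A m)] [∀ m, CompleteSpace (B m)]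
    (h : IsSplitting v e σ α lu β ls) {m : M} {z w : Z m} {g : ℕ → ℝ} {K K' c C : ℝ}
    (hK : 0 ≤ K) (hg : ∀ k, ∏ j ∈ range k, (ls (base v m j) : ℝ) ≤ K * g k) (hg0 : ∀ k, 0 ≤ g k)
    (hc0 : 0 ≤ c) (hc1 : c < 1)
    (hg' : ∀ k, (∏ j ∈ range k, (lu (base v m j) : ℝ)) * g k ≤ K' * c ^ k)
    (hd : ∀ k, dist (orb v e m z k) (orb v e m w k) ≤ C * g k) : InCone v e σ β ls m z w := by
  obtain ⟨z', hz'1, hz'⟩ := h.exists_inCone m w (σ m z).1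
  obtain ⟨D, hD, hd'⟩ := hz'.dist_le h
  obtain ⟨F, G, θ, hs⟩ := h.seqDichotomy m
  -- The cone orbit `z'` starts over the same point of `A m` as `z`, and both stay close to `w` at
  -- the slow rate. Hence they stay slowly close to each other, and unstable expansion forces
  -- equality.
  have heq : σ m z' = σ m z := by
    refine hs.eq_of_growth (z := fun k => σ _ (orb v e m z' k))
      (w := fun k => σ _ (orb v e m z k)) (orb_mem v e σ m z') (orb_mem v e σ m z) hz'1
      (C := D * K + max C 0) hc0 hc1 hg' (fun k => ?_) (by positivity)
    rw [← h.dist_σ]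
    calc _ ≤ _ := dist_triangle_right _ _ (orb v e m w k)
      _ ≤ D * (K * g k) + max C 0 * g k := by
        refine add_le_add ((hd' k).trans ?_) ((hd k).trans ?_)
        · exact mul_le_mul_of_nonneg_left (hg k) hD
        · exact mul_le_mul_of_nonneg_right (le_max_left _ _) (hg0 k)
      _ = _ := by ring
  rwa [(σ m).injective heq] at hz'

/-- `ε` lies between the contraction rate of the stable cone and the expansion rate of the unstable
cone. -/
structure IsGap (lu ls ε : M → ℝ≥0) : Prop where
  lower : ∀ m, ls m ≤ ε m
  upper : SupLtOne fun m => lu m * ε m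

theorem IsGap.prod_lower {lu ls ε : M → ℝ≥0} (hε : IsGap lu ls ε) (v : M → M) (m : M) (k : ℕ) :
    ∏ j ∈ range k, (ls (base v m j) : ℝ) ≤ ∏ j ∈ range k, (ε (base v m j) : ℝ) :=
  prod_le_prod (fun _ _ => by positivity) (fun j _ => mod_cast hε.lower _)

theorem prod_upper {lu ε : M → ℝ≥0} {c : ℝ≥0} (hc : ∀ m, lu m * ε m ≤ c) (v : M → M) (m : M)
    (k : ℕ) : (∏ j ∈ range k, (lu (base v m j) : ℝ)) * ∏ j ∈ range k, (ε (base v m j) : ℝ) ≤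
      (c : ℝ) ^ k := by
  rw [← prod_mul_distrib]
  calc ∏ j ∈ range k, ((lu (base v m j) : ℝ) * ε (base v m j)) ≤ ∏ j ∈ range k, (c : ℝ) :=
        prod_le_prod (fun _ _ => by positivity) (fun j _ => mod_cast hc _)
    _ = (c : ℝ) ^ k := by simp

/-- The cone condition does not mention `ε`, so all rates in the gap define the same leaves. From
left to right, slow growth excludes an unstable difference; from right to left, cone orbits contract
at rate `ls ≤ ε`. -/
theorem asymp_iff_inCone [∀ m, CompleteSpace (A m)] [∀ m, CompleteSpace (B m)]
    (h : IsSplitting v e σ α lu β ls) {ε : M → ℝ≥0} (hε : IsGap lu ls ε) {m : M} {z w : Z m} :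
    Asymp v e ε m z w ↔ InCone v e σ β ls m z w := by
  constructor
  · rintro ⟨C, hC⟩
    obtain ⟨c, hc1, hc⟩ := hε.upper
    exact h.inCone_of_growth (K := 1) (K' := 1) (c := c) zero_le_one
      (fun k => by rw [one_mul]; exact hε.prod_lower v m k)
      (fun k => prod_nonneg fun _ _ => by positivity)
      c.coe_nonneg (mod_cast hc1) (fun k => by rw [one_mul]; exact prod_upper hc v m k) hC
  · intro hzw
    obtain ⟨C, hC0, hC⟩ := hzw.dist_le h
    exact ⟨C, fun k => (hC k).trans (mul_le_mul_of_nonneg_left (hε.prod_lower v m k) hC0)⟩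

theorem exists_asymp [∀ m, CompleteSpace (A m)] [∀ m, CompleteSpace (B m)]
    (h : IsSplitting v e σ α lu β ls) {ε : M → ℝ≥0} (hε : IsGap lu ls ε) (m : M) (z : Z m)
    (a : A m) : ∃ w, Asymp v e ε m z w ∧ (σ m w).1 = a := by
  obtain ⟨w, hw, hc⟩ := h.exists_inCone m z a
  exact ⟨w, ((h.asymp_iff_inCone hε).2 hc).symm, hw⟩

theorem dist_snd_le [∀ m, CompleteSpace (A m)] [∀ m, CompleteSpace (B m)]
    (h : IsSplitting v e σ α lu β ls) {ε : M → ℝ≥0} (hε : IsGap lu ls ε) {m : M} {z w : Z m}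
    (hzw : Asymp v e ε m z w) : dist (σ m z).2 (σ m w).2 ≤ β m * dist (σ m z).1 (σ m w).1 :=
  ((h.asymp_iff_inCone hε).1 hzw 0).1

theorem dist_fst_apply_le [∀ m, CompleteSpace (A m)] [∀ m, CompleteSpace (B m)]
    (h : IsSplitting v e σ α lu β ls) {ε : M → ℝ≥0} (hε : IsGap lu ls ε) {m : M} {z w : Z m}
    (hzw : Asymp v e ε m z w) :
    dist (σ _ (e m z)).1 (σ _ (e m w)).1 ≤ ls m * dist (σ m z).1 (σ m w).1 :=
  ((h.asymp_iff_inCone hε).1 hzw 0).2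

theorem eq_of_asymp [∀ m, CompleteSpace (A m)] [∀ m, CompleteSpace (B m)]
    (h : IsSplitting v e σ α lu β ls) {ε : M → ℝ≥0} (hε : IsGap lu ls ε) {m : M} {z w : Z m}
    (hzw : Asymp v e ε m z w) (h1 : (σ m z).1 = (σ m w).1) : z = w := by
  have h2 := h.dist_snd_le hε hzw
  rw [h1, dist_self, mul_zero] at h2
  exact (σ m).injective (Prod.ext h1 (dist_le_zero.1 h2))

/-- Close to a pseudo-invariant section there are orbits of slow growth. -/
theorem exists_shadowing [∀ m, CompleteSpace (A m)] [∀ m, CompleteSpace (B m)]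
    (h : IsSplitting v e σ α lu β ls) {i : ∀ m, Z m} {η : M → ℝ≥0} (hη : ∀ m, η (v m) ≤ η m)
    (hi : ∀ m, ∃ p, dist p (i m) ≤ η m ∧ dist (e m p) (i (v m)) ≤ η m)
    {ε : M → ℝ≥0} (hε1 : ∀ m, 1 ≤ ε m) {q : ℝ≥0} (hq : q < 1) (hlsε : ∀ m, ls m ≤ q * ε m)
    (hε : SupLtOne fun m => lu m * ε m) (m : M) :
    ∃ z : Z m, ∃ C : ℝ, ∀ k, dist (orb v e m z k) (i (base v m k)) ≤
      C * ∏ j ∈ range k, (ε (base v m j) : ℝ) := by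
  obtain ⟨F, G, θ, hs⟩ := h.seqDichotomy m
  obtain ⟨K, hK⟩ := h.bdd
  obtain ⟨c, hc1, hc⟩ := hε
  have hηk : ∀ k, (η (base v m k) : ℝ) ≤ η m := by
    intro k
    induction k with
    | zero => exact le_rfl
    | succ k ih => exact le_trans (mod_cast hη _) ih
  obtain ⟨z, hz, C, hC⟩ := hs.exists_shadowing_orbit (B := K) (fun k => (hK _).1)
    (fun k => (hK _).2.2.1) (fun k => (hK _).2.2.2) (fun k => (hK _).2.1)
    (i := fun k => σ _ (i (base v m k))) (η := η m) (fun k => by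
      obtain ⟨p, hp1, hp2⟩ := hi (base v m k)
      refine ⟨σ _ p, σ _ (e _ p), mem_splitRel v e σ _ p, ?_, ?_⟩
      · rw [← h.dist_σ]; exact hp1.trans (hηk k)
      · exact (h.dist_σ _ _ _).symm.trans_le (hp2.trans (hηk k)))
    (ε := fun k => ε (base v m k)) (fun k => hε1 _) hq (fun k => hlsε _) (fun k => hc _) hc1
  refine ⟨(σ m).symm (z 0), C, fun k => ?_⟩
  rw [h.dist_σ, ← eq_orb hz]
  exact hC k

/-- The inverse of a bundle map with a splitting has the splitting with exchanged factors. -/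
theorem symm {u : M ≃ M} {e : ∀ m, Z m ≃ Z (u m)}
    (h : IsSplitting u (fun m => e m) σ α lu β ls) :
    IsSplitting u.symm (symmMap u e) (fun m => (σ m).trans (Equiv.prodComm _ _))
      (fun m => β (u.symm m)) (fun m => ls (u.symm m)) (fun m => α (u.symm m))
      (fun m => lu (u.symm m)) := by
  -- Reversing a step exchanges domain and range as well as the two factors, which turns (A) into
  -- (B) and `(F, G)` into `(G, F)`.
  have key : ∀ n m (_ : u n = m) (T : Z m → Z n) (_ : ∀ z, e n (T z) ≍ z),
      (∃ F G, HasGeneratingMap {p : (B m × A m) × (B n × A n) |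
        T ((σ m).symm p.1.swap) = (σ n).symm p.2.swap} F G) ∧
      ABCondition {p : (B m × A m) × (B n × A n) |
        T ((σ m).symm p.1.swap) = (σ n).symm p.2.swap} (β n) (ls n) (α n) (lu n) := by
    rintro n _ rfl T hT
    have hmem : ∀ (p : B (u n) × A (u n)) (q : B n × A n),
        T ((σ (u n)).symm p.swap) = (σ n).symm q.swap ↔
          (q.swap, p.swap) ∈ splitRel u (fun m => e m) σ n := by
      intro p q
      have hT' : ∀ z, e n (T z) = z := fun z => eq_of_heq (hT z)
      rw [← (e n).injective.eq_iff, hT', eq_comm]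
      rfl
    obtain ⟨F, G, hFG⟩ := h.gen n
    have hab := h.ab n
    refine ⟨⟨fun y x => G x y, fun y x => F x y, fun y₂ x₂ y₁ x₁ => ?_⟩, ?_, ?_, ?_, ?_⟩
    · exact (hmem _ _).trans ((hFG _ _ _ _).trans and_comm)
    · exact fun z z' w w' h1 h2 => hab.B1 _ _ _ _ ((hmem _ _).1 h1) ((hmem _ _).1 h2)
    · exact fun z z' w w' h1 h2 => hab.B2 _ _ _ _ ((hmem _ _).1 h1) ((hmem _ _).1 h2)
    · exact fun z z' w w' h1 h2 => hab.A1 _ _ _ _ ((hmem _ _).1 h1) ((hmem _ _).1 h2)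
    · exact fun z z' w w' h1 h2 => hab.A2 _ _ _ _ ((hmem _ _).1 h1) ((hmem _ _).1 h2)
  have key' := fun m => key (u.symm m) m (u.apply_symm_apply m) (symmMap u e m)
    (apply_symmMap_heq u e m)
  obtain ⟨K, hK⟩ := h.bdd
  obtain ⟨θ, hθ, hα⟩ := h.angle
  obtain ⟨c, hc1, hc⟩ := h.spectral
  refine ⟨fun m z w => ?_, fun m => (key' m).1, fun m => (key' m).2, ⟨K, fun m => ?_⟩,
    ⟨θ, hθ, fun m => ?_⟩, fun m => ?_, fun m => ?_, ⟨c, hc1, fun m => ?_⟩⟩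
  · rw [h.dist_eq, max_comm]; rfl
  · obtain ⟨h1, h2, h3, h4⟩ := hK (u.symm m)
    exact ⟨h3, h4, h1, h2⟩
  · have := hα (u.symm (u.symm m))
    dsimp only at this ⊢
    rwa [u.apply_symm_apply, mul_comm] at this
  · simpa using h.β_anti (u.symm (u.symm m))
  · simpa using h.α_mono (u.symm (u.symm m))
  · exact (mul_comm _ _).trans_le (hc (u.symm m))

end IsSplitting

end Bundles

/-! ### Orbits that stay slowly close to the section -/

section GrowthSets

variable {M : Type*} {Z A B : M → Type*} [∀ m, MetricSpace (Z m)] [∀ m, MetricSpace (A m)]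
  [∀ m, MetricSpace (B m)]

/-- The points whose forward orbit has a distance to the section `i` that grows at most like
`∏ j < k, ε (v^j m)`. -/
def growthSet (v : M → M) (e : ∀ m, Z m → Z (v m)) (i : ∀ m, Z m) (ε : M → ℝ≥0) (m : M) :
    Set (Z m) :=
  {z | ∃ C : ℝ, ∀ k, dist (orb v e m z k) (i (base v m k)) ≤
    C * ∏ j ∈ range k, (ε (base v m j) : ℝ)}

section Basic

variable {v : M → M} {e : ∀ m, Z m → Z (v m)} {i : ∀ m, Z m} {ε ε' : M → ℝ≥0} {m : M} {z w : Z m}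

theorem growthSet_subset_of_prod_le {K : ℝ}
    (h : ∀ k, ∏ j ∈ range k, (ε (base v m j) : ℝ) ≤ K * ∏ j ∈ range k, (ε' (base v m j) : ℝ)) :
    growthSet v e i ε m ⊆ growthSet v e i ε' m := by
  rintro z ⟨C, hC⟩
  refine ⟨max C 0 * K, fun k => (hC k).trans ?_⟩
  rw [mul_assoc]
  exact mul_le_mul (le_max_left _ _) (h k) (prod_nonneg fun _ _ => by positivity) (le_max_right _ _)

theorem growthSet_mono (h : ∀ m, ε m ≤ ε' m) : growthSet v e i ε m ⊆ growthSet v e i ε' m :=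
  growthSet_subset_of_prod_le (K := 1) fun k => by
    rw [one_mul]
    exact prod_le_prod (fun _ _ => by positivity) (fun j _ => mod_cast h _)

theorem prod_comp_base (v : M → M) (ε : M → ℝ≥0) (m : M) (k : ℕ) :
    ε m * ∏ j ∈ range k, (ε (v (base v m j)) : ℝ) = ∏ j ∈ range (k + 1), (ε (base v m j) : ℝ) := by
  rw [prod_range_succ', mul_comm]
  rfl

/-- Evaluating `ε` at the end rather than at the start of each step changes the product only by its
first and last factors. One inclusion needs `1 ≤ ε`, the converse below also an upper bound. -/
theorem growthSet_subset_comp (h : ∀ m, 1 ≤ ε m) :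
    growthSet v e i ε m ⊆ growthSet v e i (fun m => ε (v m)) m :=
  growthSet_subset_of_prod_le (K := ε m) fun k => by
    rw [prod_comp_base, prod_range_succ]
    exact le_mul_of_one_le_right (prod_nonneg fun _ _ => by positivity) (mod_cast h _)

theorem growthSet_comp_subset {K : ℝ≥0} (h : ∀ m, 1 ≤ ε m) (hK : ∀ m, ε m ≤ K) :
    growthSet v e i (fun m => ε (v m)) m ⊆ growthSet v e i ε m :=
  growthSet_subset_of_prod_le (K := K) fun k => by
    have h0 : 0 ≤ ∏ j ∈ range k, (ε (v (base v m j)) : ℝ) := prod_nonneg fun _ _ => by positivity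
    have h1 := le_mul_of_one_le_left h0 (show (1 : ℝ) ≤ ε m from mod_cast h m)
    rw [prod_comp_base, prod_range_succ, mul_comm] at h1
    refine h1.trans (mul_le_mul_of_nonneg_right (mod_cast hK _) (prod_nonneg fun _ _ => ?_))
    positivity

theorem asymp_of_mem_growthSet (hz : z ∈ growthSet v e i ε m) (hw : w ∈ growthSet v e i ε m) :
    Asymp v e ε m z w := by
  obtain ⟨C, hC⟩ := hz
  obtain ⟨C', hC'⟩ := hw
  refine ⟨C + C', fun k => ?_⟩
  rw [add_mul]
  exact (dist_triangle_right _ _ _).trans (add_le_add (hC k) (hC' k))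

theorem mem_growthSet_iff_asymp (hz : z ∈ growthSet v e i ε m) :
    w ∈ growthSet v e i ε m ↔ Asymp v e ε m z w := by
  refine ⟨asymp_of_mem_growthSet hz, fun ⟨C, hC⟩ => ?_⟩
  obtain ⟨C', hC'⟩ := hz
  refine ⟨C + C', fun k => ?_⟩
  rw [add_mul]
  exact (dist_triangle_left _ _ _).trans (add_le_add (hC k) (hC' k))

theorem mem_growthSet_apply_iff (hε : ∀ m, 0 < ε m) :
    z ∈ growthSet v e i ε m ↔ e m z ∈ growthSet v e i ε (v m) := by
  have hd : ∀ k, dist (orb v e (v m) (e m z) k) (i (base v (v m) k)) =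
      dist (orb v e m z (k + 1)) (i (base v m (k + 1))) := fun k =>
    congrArg (fun p : Σ m, Z m × Z m => dist p.2.1 (i p.1)) (orb_shift v e m z z k)
  have hm : (0 : ℝ) < ε m := mod_cast hε m
  constructor
  · rintro ⟨C, hC⟩
    refine ⟨C * ε m, fun k => ?_⟩
    rw [hd, mul_assoc, ← prod_base_succ]
    exact hC (k + 1)
  · rintro ⟨C, hC⟩
    refine ⟨max (dist z (i m)) (C / ε m), fun k => ?_⟩
    cases k with
    | zero =>
      rw [range_zero, prod_empty, mul_one]
      exact le_max_left _ _
    | succ k =>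
      rw [← hd, prod_base_succ, ← mul_assoc]
      refine (hC k).trans ?_
      gcongr
      rw [← div_le_iff₀ hm]
      exact le_max_right _ _

end Basic

theorem mem_growthSet_symmMap_iff (u : M ≃ M) (e : ∀ m, Z m ≃ Z (u m)) {i : ∀ m, Z m}
    {ε : M → ℝ≥0} (hε : ∀ m, 0 < ε m) (m : M) (z : Z m) :
    z ∈ growthSet u.symm (symmMap u e) i ε m ↔
      e m z ∈ growthSet u.symm (symmMap u e) i ε (u m) :=
  rel_apply_iff_of_symmMap u e
    (R := fun m z _ => z ∈ growthSet u.symm (symmMap u e) i ε m)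
    (fun _ _ _ => mem_growthSet_apply_iff hε) m z z

theorem forwardSet_eq_growthSet (u : M ≃ M) (e : ∀ m, Z m ≃ Z (u m))
    {H : ∀ m, SetRel (Z m) (Z (u m))} (hH : ∀ m z w, (z, w) ∈ H m ↔ e m z = w) (i : ∀ m, Z m)
    (ε : M → ℝ≥0) (m : M) : forwardSet u H i ε m = growthSet u (fun m => e m) i ε m := by
  have hc : ∀ k, (cocycle u ε k m : ℝ) = ∏ j ∈ range k, (ε (base u m j) : ℝ) := fun k => by
    simp [cocycle, base_eq_iterate]
  ext z
  constructor
  · rintro ⟨ζ, h0, hζ, C, hC⟩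
    have key : ∀ k, ζ k = ⟨base u m k, orb u (fun m => e m) m z k⟩ := by
      intro k
      induction k with
      | zero => exact h0
      | succ k ih =>
        obtain ⟨n, a, b, hab, heq⟩ := hζ k
        rw [Prod.mk.injEq] at heq
        obtain rfl := (hH _ _ _).1 hab
        rw [heq.2]
        exact congrArg (fun p : Σ m, Z m => (⟨u p.1, e _ p.2⟩ : Σ m, Z m)) (heq.1.symm.trans ih)
    refine ⟨C, fun k => ?_⟩
    rw [← hc]
    have := hC k
    rwa [key] at this
  · rintro ⟨C, hC⟩
    refine ⟨fun k => ⟨base u m k, orb u (fun m => e m) m z k⟩, rfl, fun k => ?_, C, fun k => ?_⟩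
    · exact ⟨_, _, _, (hH _ _ _).2 rfl, rfl⟩
    · rw [hc]
      exact hC k

theorem backwardSet_eq_growthSet (u : M ≃ M) (e : ∀ m, Z m ≃ Z (u m))
    {H : ∀ m, SetRel (Z m) (Z (u m))} (hH : ∀ m z w, (z, w) ∈ H m ↔ e m z = w) (i : ∀ m, Z m)
    (ε : M → ℝ≥0) (m : M) :
    backwardSet u H i ε m = growthSet u.symm (symmMap u e) i ε m := by
  have hc : ∀ k, (cocycle u.symm ε k m : ℝ) = ∏ j ∈ range k, (ε (base u.symm m j) : ℝ) :=
    fun k => by simp [cocycle, base_eq_iterate]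
  ext z
  constructor
  · rintro ⟨ζ, h0, hζ, C, hC⟩
    have key : ∀ k, ζ k = ⟨base u.symm m k, orb u.symm (symmMap u e) m z k⟩ := by
      intro k
      induction k with
      | zero => exact h0
      | succ k ih =>
        obtain ⟨n, a, b, hab, heq⟩ := hζ k
        rw [Prod.mk.injEq] at heq
        obtain rfl := (hH _ _ _).1 hab
        rw [heq.1]
        have h1 : (⟨n, a⟩ : Σ m, Z m) = ⟨u.symm (u n), symmMap u e (u n) (e n a)⟩ :=
          Sigma.ext (u.symm_apply_apply n).symm (symmMap_apply_heq u e n a).symm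
        exact h1.trans (congrArg (fun p : Σ m, Z m => (⟨u.symm p.1, symmMap u e _ p.2⟩ : Σ m, Z m))
          (heq.2.symm.trans ih))
    refine ⟨C, fun k => ?_⟩
    rw [← hc]
    have := hC k
    rwa [key] at this
  · rintro ⟨C, hC⟩
    refine ⟨fun k => ⟨base u.symm m k, orb u.symm (symmMap u e) m z k⟩, rfl, fun k => ?_, C,
      fun k => ?_⟩
    · refine ⟨_, _, _, (hH (u.symm (base u.symm m k)) _ _).2 rfl, Prod.ext rfl ?_⟩
      exact Sigma.ext (u.apply_symm_apply _).symm (apply_symmMap_heq u e _ _).symm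
    · rw [hc]
      exact hC k

/-- The section `i` is invariant up to an error `η` which does not grow along `v`. -/
def IsPseudoInvariant (v : M → M) (e : ∀ m, Z m → Z (v m)) (i : ∀ m, Z m) (η : M → ℝ≥0) : Prop :=
  (∀ m, η (v m) ≤ η m) ∧ ∀ m, ∃ p, dist p (i m) ≤ η m ∧ dist (e m p) (i (v m)) ≤ η m

theorem IsPseudoInvariant.symm {u : M ≃ M} {e : ∀ m, Z m ≃ Z (u m)} {i : ∀ m, Z m} {η : M → ℝ≥0}
    (h : IsPseudoInvariant u (fun m => e m) i η) (hη : ∀ m, η m ≤ η (u m)) :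
    IsPseudoInvariant u.symm (symmMap u e) i η := by
  have key : ∀ n m (_ : u n = m) (T : Z m → Z n) (_ : ∀ z, e n (T z) ≍ z),
      ∃ p, dist p (i m) ≤ η m ∧ dist (T p) (i n) ≤ η m := by
    rintro n _ rfl T hT
    obtain ⟨p, h1, h2⟩ := h.2 n
    have hη' : (η n : ℝ) ≤ η (u n) := mod_cast hη n
    -- The image of the point that nearly follows `i` forward nearly follows `i` backward.
    refine ⟨e n p, h2.trans hη', ?_⟩
    rw [(e n).injective (eq_of_heq (hT (e n p)))]
    exact h1.trans hη'
  exact ⟨fun m => by simpa using hη (u.symm m), fun m =>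
    key (u.symm m) m (u.apply_symm_apply m) (symmMap u e m) (apply_symmMap_heq u e m)⟩

/-- The smallest growth function whose distance to `ls` is at least `ς`. -/
def minGrowth (ls : M → ℝ≥0) (ς : ℝ≥0) (m : M) : ℝ≥0 := max 1 (ls m + ς)

theorem one_le_minGrowth (ls : M → ℝ≥0) (ς : ℝ≥0) (m : M) : 1 ≤ minGrowth ls ς m :=
  le_max_left _ _

theorem minGrowth_mono (ls : M → ℝ≥0) {ς ς' : ℝ≥0} (h : ς ≤ ς') (m : M) :
    minGrowth ls ς m ≤ minGrowth ls ς' m := by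
  unfold minGrowth
  gcongr

/-- The bound on `lu * ls` leaves room for adding a small `ς` to `ls`; the bound on `lu` alone makes
the rate `1` admissible. -/
theorem exists_isGap_minGrowth {lu ls : M → ℝ≥0} (h1 : SupLtOne lu)
    (h2 : SupLtOne fun m => lu m * ls m) :
    ∃ ς₀ : ℝ≥0, 0 < ς₀ ∧ ∀ ς ≤ ς₀, IsSplitting.IsGap lu ls (minGrowth ls ς) := by
  obtain ⟨c₁, hc₁, h1⟩ := h1
  obtain ⟨c₂, hc₂, h2⟩ := h2
  obtain ⟨c, hc0, hc⟩ := exists_between (max_lt hc₁ hc₂)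
  refine ⟨c - max c₁ c₂, tsub_pos_of_lt hc0, fun ς hς => ⟨fun m => ?_, c, hc, fun m => ?_⟩⟩
  · exact le_self_add.trans (le_max_right _ _)
  · have hle : max c₁ c₂ + ς ≤ c := by
      rw [add_comm]; exact (le_tsub_iff_right hc0.le).1 hς
    have hl : lu m ≤ max c₁ c₂ := (h1 m).trans (le_max_left _ _)
    change lu m * max 1 (ls m + ς) ≤ c
    rw [mul_max, mul_one, mul_add]
    refine max_le (hl.trans hc0.le) (le_trans ?_ hle)
    refine add_le_add ((h2 m).trans (le_max_right _ _)) ?_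
    exact mul_le_of_le_one_left zero_le (hl.trans (hc0.trans hc).le)

theorem IsGrowthFunction.isGap {lo hi ε : M → ℝ≥0} (h : IsGrowthFunction lo hi ε) :
    IsSplitting.IsGap hi lo ε :=
  let ⟨_, _, hς⟩ := h.lower
  ⟨fun m => le_self_add.trans (hς m), h.upper⟩

theorem IsGrowthFunction.exists_minGrowth_le {lo hi ε : M → ℝ≥0} (h : IsGrowthFunction lo hi ε)
    {ς₀ : ℝ≥0} (h0 : 0 < ς₀) :
    ∃ ς, 0 < ς ∧ ς ≤ ς₀ ∧ ∀ m, minGrowth lo ς m ≤ ε m := by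
  obtain ⟨ς, hς, hle⟩ := h.lower
  refine ⟨min ς ς₀, lt_min hς h0, min_le_right _ _, fun m => max_le (h.one_le m) ?_⟩
  exact (add_le_add_right (min_le_left _ _) _).trans (hle m)

namespace IsSplitting

variable {v : M → M} {e : ∀ m, Z m → Z (v m)} {σ : ∀ m, Z m ≃ A m × B m} {α lu β ls : M → ℝ≥0}

theorem IsGap.comp {ε : M → ℝ≥0} (h : IsGap lu ls ε) (v : M → M) :
    IsGap (fun m => lu (v m)) (fun m => ls (v m)) (fun m => ε (v m)) :=
  let ⟨c, hc, hle⟩ := h.upper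
  ⟨fun m => h.lower (v m), c, hc, fun m => hle (v m)⟩

variable [∀ m, CompleteSpace (A m)] [∀ m, CompleteSpace (B m)]

/-- Both sets are the leaf of the common point `w`, and leaves do not depend on the rate within the
gap. -/
theorem growthSet_eq (h : IsSplitting v e σ α lu β ls) {i : ∀ m, Z m} {ε ε' : M → ℝ≥0}
    (hε : IsGap lu ls ε) (hε' : IsGap lu ls ε') {m : M} {w : Z m}
    (hw : w ∈ growthSet v e i ε m) (hw' : w ∈ growthSet v e i ε' m) :
    growthSet v e i ε m = growthSet v e i ε' m := by
  ext z
  rw [mem_growthSet_iff_asymp hw, mem_growthSet_iff_asymp hw', h.asymp_iff_inCone hε,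
    h.asymp_iff_inCone hε']

theorem nonempty_growthSet (h : IsSplitting v e σ α lu β ls) {i : ∀ m, Z m} {η : M → ℝ≥0}
    (hi : IsPseudoInvariant v e i η) {ς : ℝ≥0} (hς : 0 < ς) (hgap : IsGap lu ls (minGrowth ls ς))
    (m : M) : (growthSet v e i (minGrowth ls ς) m).Nonempty := by
  obtain ⟨K, hK⟩ := h.bdd
  have hKς : 0 < K + ς := add_pos_of_nonneg_of_pos zero_le hς
  -- For `ls ≤ K` an additive margin `ς` is a multiplicative one: `ls ≤ K / (K + ς) * (ls + ς)`.
  refine h.exists_shadowing hi.1 hi.2 (one_le_minGrowth ls ς) (q := K / (K + ς))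
    ((div_lt_one hKς).2 (lt_add_of_pos_right _ hς)) (fun m => ?_) hgap.upper m
  have h1 : ls m ≤ K / (K + ς) * (ls m + ς) := by
    rw [div_mul_eq_mul_div, le_div_iff₀ hKς, mul_add, mul_add, mul_comm]
    gcongr
    exact (hK m).2.2.2
  exact h1.trans (by gcongr; exact le_max_right _ _)

/-- The set of points with slowly growing forward orbits does not depend on the growth function. -/
theorem growthSet_eq_minGrowth (h : IsSplitting v e σ α lu β ls) {i : ∀ m, Z m} {η : M → ℝ≥0}
    (hi : IsPseudoInvariant v e i η) {ς₀ : ℝ≥0} (h0 : 0 < ς₀)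
    (hgap : ∀ ς ≤ ς₀, IsGap lu ls (minGrowth ls ς)) {ε : M → ℝ≥0} (hε : IsGrowthFunction ls lu ε)
    (m : M) : growthSet v e i ε m = growthSet v e i (minGrowth ls ς₀) m := by
  obtain ⟨ς, hς, hle, hςε⟩ := hε.exists_minGrowth_le h0
  obtain ⟨w, hw⟩ := h.nonempty_growthSet hi hς (hgap ς hle) m
  exact h.growthSet_eq hε.isGap (hgap ς₀ le_rfl) (growthSet_mono hςε hw)
    (growthSet_mono (minGrowth_mono ls hle) hw)

/-- A variant of `growthSet_eq_minGrowth` in which the rates are evaluated at the endpoint of a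
step. -/
theorem growthSet_eq_minGrowth_comp {lu ls : M → ℝ≥0}
    (h : IsSplitting v e σ α (fun m => lu (v m)) β (fun m => ls (v m)))
    {K : ℝ≥0} (hK : ∀ m, ls m ≤ K) {i : ∀ m, Z m} {η : M → ℝ≥0}
    (hi : IsPseudoInvariant v e i η) {ς₀ : ℝ≥0} (h0 : 0 < ς₀)
    (hgap : ∀ ς ≤ ς₀, IsGap lu ls (minGrowth ls ς)) {ε : M → ℝ≥0} (hε : IsGrowthFunction ls lu ε)
    (m : M) : growthSet v e i ε m = growthSet v e i (fun m => minGrowth ls ς₀ (v m)) m := by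
  obtain ⟨ς, hς, hle, hςε⟩ := hε.exists_minGrowth_le h0
  obtain ⟨w, hw⟩ := h.nonempty_growthSet hi hς ((hgap ς hle).comp v) m
  have hw : w ∈ growthSet v e i (fun m => minGrowth ls ς (v m)) m := hw
  have hw0 : w ∈ growthSet v e i (fun m => minGrowth ls ς₀ (v m)) m :=
    growthSet_mono (fun m => minGrowth_mono ls hle (v m)) hw
  have hg0 := (hgap ς₀ le_rfl).comp v
  -- No upper bound on `ε` is available, so the second inclusion passes through the bounded function
  -- `minGrowth ls ς ≤ ε`.
  apply Set.Subset.antisymm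
  · rw [h.growthSet_eq hg0 (hε.isGap.comp v) hw0 (growthSet_mono (fun m => hςε (v m)) hw)]
    exact growthSet_subset_comp hε.one_le
  · rw [h.growthSet_eq hg0 ((hgap ς hle).comp v) hw0 hw]
    refine (growthSet_comp_subset (one_le_minGrowth ls ς) (K := max 1 (K + ς)) fun m => ?_).trans
      (growthSet_mono hςε)
    unfold minGrowth
    have := hK m
    gcongr

end IsSplitting

end GrowthSets

/-! ### Intersections of transversal Lipschitz graphs -/

section Transversality

/-- A graph over the first factor and a graph over the second factor of a product meet in exactly
one point if the product of their Lipschitz constants is less than one. -/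
theorem existsUnique_mem_inter {Z A B : Type*} [MetricSpace A] [MetricSpace B] [CompleteSpace B]
    [Nonempty B] (σ : Z ≃ A × B) {P Q : Z → Prop} {a b : ℝ≥0} (hab : b * a < 1)
    (hP : ∀ x, ∃ w, P w ∧ (σ w).1 = x) (hQ : ∀ y, ∃ w, Q w ∧ (σ w).2 = y)
    (hP' : ∀ z w, P z → P w → dist (σ z).2 (σ w).2 ≤ b * dist (σ z).1 (σ w).1)
    (hQ' : ∀ z w, Q z → Q w → dist (σ z).1 (σ w).1 ≤ a * dist (σ z).2 (σ w).2) :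
    ∃! w, P w ∧ Q w := by
  choose f hf hf1 using hP
  choose g hg hg2 using hQ
  -- From `y`, go to the `Q`-point over `y`, then to the `P`-point over its first component; a fixed
  -- point lies on both graphs.
  have hc : ContractingWith (b * a) (fun y => (σ (f (σ (g y)).1)).2) := by
    refine ⟨hab, LipschitzWith.of_dist_le_mul fun y y' => ?_⟩
    refine (hP' _ _ (hf _) (hf _)).trans ?_
    rw [hf1, hf1, NNReal.coe_mul, mul_assoc]
    gcongr
    refine (hQ' _ _ (hg _) (hg _)).trans_eq ?_
    rw [hg2, hg2]
  have hy := hc.fixedPoint_isFixedPt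
  set y := ContractingWith.fixedPoint _ hc
  have heq : f (σ (g y)).1 = g y :=
    σ.injective (Prod.ext (hf1 _) (Eq.trans hy (hg2 y).symm))
  refine ⟨g y, ⟨heq ▸ hf _, hg y⟩, fun w ⟨hw1, hw2⟩ => ?_⟩
  have hgP : P (g y) := heq ▸ hf _
  have h1 := hP' _ _ hw1 hgP
  have h2 := hQ' _ _ hw2 (hg y)
  have h3 : dist (σ w).2 (σ (g y)).2 ≤ (b * a : ℝ≥0) * dist (σ w).2 (σ (g y)).2 := by
    push_cast
    rw [mul_assoc]
    exact h1.trans (mul_le_mul_of_nonneg_left h2 b.coe_nonneg)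
  have hab' : ((b * a : ℝ≥0) : ℝ) < 1 := mod_cast hab
  have h4 : dist (σ w).2 (σ (g y)).2 = 0 := by
    nlinarith [dist_nonneg (x := (σ w).2) (y := (σ (g y)).2)]
  rw [h4, mul_zero] at h2
  exact σ.injective (Prod.ext (dist_le_zero.1 h2) (dist_eq_zero.1 h4))

section Center

variable {S C U : Type*} [MetricSpace S] [MetricSpace C] [MetricSpace U]
  {P Q : S × C × U → Prop} {a b : ℝ≥0}

/-- The distance of two points in the intersection of a center-stable and a center-unstable graph
is the distance of their center components. -/
theorem dist_le_center (ha : a ≤ 1) (hb : b ≤ 1) (hab : b * a < 1) {z w : S × C × U}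
    (hP : dist z.2.2 w.2.2 ≤ b * dist (z.1, z.2.1) (w.1, w.2.1))
    (hQ : dist z.1 w.1 ≤ a * dist z.2 w.2) :
    dist z.1 w.1 ≤ dist z.2.1 w.2.1 ∧ dist z.2.2 w.2.2 ≤ dist z.2.1 w.2.1 := by
  rw [Prod.dist_eq] at hP hQ
  dsimp only at hP hQ
  have ha' : (a : ℝ) ≤ 1 := mod_cast ha
  have hb' : (b : ℝ) ≤ 1 := mod_cast hb
  have hab' : (b : ℝ) * a < 1 := mod_cast hab
  have hs : dist z.1 w.1 ≤ dist z.2.1 w.2.1 := by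
    -- If the stable distance were the largest, then `b ≤ 1`, `a ≤ 1` and `b * a < 1` would
    -- contradict it: the unstable distance is at most `b` times the stable one, which is at most
    -- `a` times the center or unstable one.
    by_contra! hlt
    have hs0 : 0 < dist z.1 w.1 := dist_nonneg.trans_lt hlt
    rw [max_eq_left hlt.le] at hP
    have hcu : dist z.2.1 w.2.1 ≤ dist z.2.2 w.2.2 := by
      by_contra! hlt'
      rw [max_eq_left hlt'.le] at hQ
      nlinarith [mul_le_of_le_one_left (dist_nonneg (x := z.2.1) (y := w.2.1)) ha']
    rw [max_eq_right hcu] at hQ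
    have := mul_le_mul_of_nonneg_left hP a.coe_nonneg
    nlinarith
  refine ⟨hs, ?_⟩
  rw [max_eq_right hs] at hP
  exact hP.trans (mul_le_of_le_one_left dist_nonneg hb')

/-- A center-stable graph and a center-unstable graph meet in a graph over the center. -/
theorem existsUnique_mem_center [CompleteSpace S] [Nonempty S] (ha : a ≤ 1) (hb : b ≤ 1)
    (hab : b * a < 1) (hP : ∀ x : S × C, ∃ w, P w ∧ (w.1, w.2.1) = x)
    (hQ : ∀ y : C × U, ∃ w, Q w ∧ w.2 = y)
    (hP' : ∀ z w, P z → P w → dist z.2.2 w.2.2 ≤ b * dist (z.1, z.2.1) (w.1, w.2.1))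
    (hQ' : ∀ z w, Q z → Q w → dist z.1 w.1 ≤ a * dist z.2 w.2) (c : C) :
    ∃! w, (P w ∧ Q w) ∧ w.2.1 = c := by
  choose f hf hf1 using hP
  choose g hg hg2 using hQ
  have hdg : ∀ u u' : U, dist (g (c, u)).1 (g (c, u')).1 ≤ a * dist u u' := fun u u' => by
    refine (hQ' _ _ (hg _) (hg _)).trans_eq ?_
    rw [hg2, hg2, Prod.dist_eq]
    simp
  have hdf : ∀ s s' : S, dist (f (s, c)).2.2 (f (s', c)).2.2 ≤ b * dist s s' := fun s s' => by
    refine (hP' _ _ (hf _) (hf _)).trans_eq ?_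
    rw [hf1, hf1, Prod.dist_eq]
    simp
  -- With the center component frozen at `c`, the stable component is fed into the `P`-graph and the
  -- resulting unstable component into the `Q`-graph.
  have hc : ContractingWith (b * a) (fun s => (g (c, (f (s, c)).2.2)).1) := by
    refine ⟨hab, LipschitzWith.of_dist_le_mul fun s s' => (hdg _ _).trans ?_⟩
    rw [NNReal.coe_mul, mul_comm (b : ℝ), mul_assoc]
    gcongr
    exact hdf _ _
  have hs := hc.fixedPoint_isFixedPt
  set s := ContractingWith.fixedPoint _ hc
  have h1 := Prod.ext_iff.1 (hf1 (s, c))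
  have heq : g (c, (f (s, c)).2.2) = f (s, c) := by
    refine Prod.ext (Eq.trans hs h1.1.symm) ((hg2 _).trans (Prod.ext h1.2.symm rfl))
  refine ⟨f (s, c), ⟨⟨hf _, heq ▸ hg _⟩, h1.2⟩, fun w ⟨⟨hw1, hw2⟩, hw3⟩ => ?_⟩
  have hQf : Q (f (s, c)) := heq ▸ hg _
  obtain ⟨h2, h3⟩ := dist_le_center ha hb hab (hP' _ _ hw1 (hf (s, c))) (hQ' _ _ hw2 hQf)
  have h4 : w.2.1 = (f (s, c)).2.1 := hw3.trans h1.2.symm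
  rw [h4, dist_self] at h2 h3
  exact Prod.ext (dist_le_zero.1 h2) (Prod.ext h4 (dist_le_zero.1 h3))

end Center

end Transversality

/-! ### Decoupling by invariant foliations -/

section Decoupling

variable {M : Type*} {Xs Xc Xu : M → Type*}

/-- Invariant foliations of `X^s × X^c × X^u` with center-stable, stable, center-unstable and
unstable leaves, and one center-stable leaf `Wcs` and one center-unstable leaf `Wcu` that are
invariant. -/
structure FoliationSystem (u : M → M) (e : ∀ m, Triple Xs Xc Xu m → Triple Xs Xc Xu (u m))
    (cs s cu un : ∀ m, Triple Xs Xc Xu m → Triple Xs Xc Xu m → Prop)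
    (Wcs Wcu : ∀ m, Set (Triple Xs Xc Xu m)) : Prop where
  equiv_cs : ∀ m, Equivalence (cs m)
  equiv_s : ∀ m, Equivalence (s m)
  equiv_cu : ∀ m, Equivalence (cu m)
  equiv_un : ∀ m, Equivalence (un m)
  s_le_cs : ∀ m z w, s m z w → cs m z w
  un_le_cu : ∀ m z w, un m z w → cu m z w
  inv_cs : ∀ m z w, cs m z w → cs (u m) (e m z) (e m w)
  inv_s : ∀ m z w, s m z w → s (u m) (e m z) (e m w)
  inv_un : ∀ m z w, un m z w → un (u m) (e m z) (e m w)
  inv_Wcs : ∀ m z, z ∈ Wcs m → e m z ∈ Wcs (u m)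
  inv_Wcu : ∀ m z, z ∈ Wcu m → e m z ∈ Wcu (u m)
  Wcs_leaf : ∀ m z w, z ∈ Wcs m → (w ∈ Wcs m ↔ cs m z w)
  Wcu_leaf : ∀ m z w, z ∈ Wcu m → (w ∈ Wcu m ↔ cu m z w)
  cs_inter_un : ∀ m z z', ∃! w, cs m z w ∧ un m z' w
  s_inter_cu : ∀ m z z', ∃! w, s m z w ∧ cu m z' w
  s_graph : ∀ m z x, ∃! w, s m z w ∧ w.1 = x
  un_graph : ∀ m z x, ∃! w, un m z w ∧ w.2.2 = x
  center_graph : ∀ m x, ∃! w, (w ∈ Wcs m ∧ w ∈ Wcu m) ∧ w.2.1 = x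
  nonempty_Wcs : ∀ m, (Wcs m).Nonempty
  nonempty_Wcu : ∀ m, (Wcu m).Nonempty

/-- Invariant foliations decouple the dynamics: the point `z` is determined by the stable component
of the intersection `p` of its unstable leaf with `Wcs`, the center component of the intersection
`c` of the stable leaf of `p` with `Wcu`, and the unstable component of the intersection of the
unstable leaf of `c` with the center-stable leaf of `z`. -/
theorem FoliationSystem.exists_decoupling {u : M → M}
    {e : ∀ m, Triple Xs Xc Xu m → Triple Xs Xc Xu (u m)}
    {cs s cu un : ∀ m, Triple Xs Xc Xu m → Triple Xs Xc Xu m → Prop}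
    {Wcs Wcu : ∀ m, Set (Triple Xs Xc Xu m)} (h : FoliationSystem u e cs s cu un Wcs Wcu) :
    ∃ (hs : ∀ m, Xs m × Xc m → Xs (u m)) (hc : ∀ m, Xc m → Xc (u m))
      (hu : ∀ m, Xc m × Xu m → Xu (u m))
      (P : ∀ m, Triple Xs Xc Xu m → Triple Xs Xc Xu m),
      (∀ m, Function.Bijective (P m)) ∧
      (∀ m z, P (u m) (e m z) =
          (hs m ((P m z).1, (P m z).2.1), hc m (P m z).2.1, hu m ((P m z).2.1, (P m z).2.2))) ∧
      ∀ m z, z ∈ Wcs m → z ∈ Wcu m → hc m z.2.1 = (e m z).2.1 := by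
  choose r hr using h.nonempty_Wcs
  choose r' hr' using h.nonempty_Wcu
  choose cen hcen hcen' using h.center_graph
  choose ps hps hps' using h.s_graph
  choose pu hpu hpu' using h.un_graph
  choose X hX hX' using h.cs_inter_un
  choose Y hY hY' using h.s_inter_cu
  dsimp only at hcen' hps' hpu' hX' hY'
  let p : ∀ m, Triple Xs Xc Xu m → Triple Xs Xc Xu m := fun m z => X m (r m) z
  let c : ∀ m, Triple Xs Xc Xu m → Triple Xs Xc Xu m := fun m z => Y m (p m z) (r' m)
  let b : ∀ m, Triple Xs Xc Xu m → Triple Xs Xc Xu m := fun m z => X m z (c m z)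
  have p_spec : ∀ m z, p m z ∈ Wcs m ∧ un m z (p m z) := fun m z =>
    ⟨(h.Wcs_leaf m _ _ (hr m)).2 (hX m _ _).1, (hX m _ _).2⟩
  have p_uniq : ∀ m z w, w ∈ Wcs m → un m z w → w = p m z := fun m z w h1 h2 =>
    hX' m _ _ w ⟨(h.Wcs_leaf m _ _ (hr m)).1 h1, h2⟩
  have c_spec : ∀ m z, s m (p m z) (c m z) ∧ c m z ∈ Wcs m ∧ c m z ∈ Wcu m := fun m z =>
    ⟨(hY m _ _).1, (h.Wcs_leaf m _ _ (p_spec m z).1).2 (h.s_le_cs _ _ _ (hY m _ _).1),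
      (h.Wcu_leaf m _ _ (hr' m)).2 (hY m _ _).2⟩
  have c_uniq : ∀ m z w, s m (p m z) w → w ∈ Wcu m → w = c m z := fun m z w h1 h2 =>
    hY' m _ _ w ⟨h1, (h.Wcu_leaf m _ _ (hr' m)).1 h2⟩
  have b_spec : ∀ m z, cs m z (b m z) ∧ un m (c m z) (b m z) := fun m z => hX m _ _
  have b_uniq : ∀ m z w, cs m z w → un m (c m z) w → w = b m z := fun m z w h1 h2 =>
    hX' m _ _ w ⟨h1, h2⟩
  -- Each construction is the unique intersection of invariant objects, so it commutes with `e`.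
  have p_e : ∀ m z, p (u m) (e m z) = e m (p m z) := fun m z =>
    (p_uniq _ _ _ (h.inv_Wcs _ _ (p_spec m z).1) (h.inv_un _ _ _ (p_spec m z).2)).symm
  have c_e : ∀ m z, c (u m) (e m z) = e m (c m z) := fun m z => by
    refine (c_uniq _ _ _ ?_ (h.inv_Wcu _ _ (c_spec m z).2.2)).symm
    rw [p_e]
    exact h.inv_s _ _ _ (c_spec m z).1
  have b_e : ∀ m z, b (u m) (e m z) = e m (b m z) := fun m z => by
    refine (b_uniq _ _ _ (h.inv_cs _ _ _ (b_spec m z).1) ?_).symm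
    rw [c_e]
    exact h.inv_un _ _ _ (b_spec m z).2
  have cen_eq : ∀ m z, z ∈ Wcs m → z ∈ Wcu m → cen m z.2.1 = z := fun m z h1 h2 =>
    (hcen' m _ z ⟨⟨h1, h2⟩, rfl⟩).symm
  have cen_c : ∀ m z, cen m (c m z).2.1 = c m z := fun m z =>
    cen_eq m _ (c_spec m z).2.1 (c_spec m z).2.2
  have ps_p : ∀ m z, ps m (c m z) (p m z).1 = p m z := fun m z =>
    (hps' m _ _ _ ⟨(h.equiv_s m).symm (c_spec m z).1, rfl⟩).symm
  have pu_b : ∀ m z, pu m (c m z) (b m z).2.2 = b m z := fun m z =>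
    (hpu' m _ _ _ ⟨(b_spec m z).2, rfl⟩).symm
  -- Each factor map rebuilds `p`, `c` or `b` from its coordinates by way of the center point,
  -- applies `e` and reads off one component.
  refine ⟨fun m x => (e m (ps m (cen m x.2) x.1)).1, fun m x => (e m (cen m x)).2.1,
    fun m x => (e m (pu m (cen m x.1) x.2)).2.2,
    fun m z => ((p m z).1, (c m z).2.1, (b m z).2.2), fun m => ⟨?_, ?_⟩, ?_, ?_⟩
  · intro z z' heq
    simp only [Prod.mk.injEq] at heq
    obtain ⟨e1, e2, e3⟩ := heq
    have hcc : c m z = c m z' := by rw [← cen_c, e2, cen_c]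
    have hpp : p m z = p m z' := by rw [← ps_p, hcc, e1, ps_p]
    have hbb : b m z = b m z' := by rw [← pu_b, hcc, e3, pu_b]
    -- The point `z` is recovered as the intersection of the center-stable leaf of `b` with the
    -- unstable leaf of `p`.
    have hz : ∀ z, z = X m (b m z) (p m z) := fun z =>
      hX' m _ _ z ⟨(h.equiv_cs m).symm (b_spec m z).1, (h.equiv_un m).symm (p_spec m z).2⟩
    rw [hz z, hz z', hpp, hbb]
  · rintro ⟨xs, xc, xu⟩
    obtain ⟨⟨q1, q2⟩, q3⟩ := hcen m xc
    set c₀ := cen m xc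
    obtain ⟨q4, q5⟩ := hps m c₀ xs
    set p₀ := ps m c₀ xs
    obtain ⟨q6, q7⟩ := hpu m c₀ xu
    set b₀ := pu m c₀ xu
    obtain ⟨q8, q9⟩ := hX m b₀ p₀
    refine ⟨X m b₀ p₀, ?_⟩
    have hp₀ : p₀ = p m (X m b₀ p₀) :=
      p_uniq m _ _ ((h.Wcs_leaf m _ _ q1).2 (h.s_le_cs _ _ _ q4)) ((h.equiv_un m).symm q9)
    have hc₀ : c₀ = c m (X m b₀ p₀) := by
      refine c_uniq m _ _ ?_ q2
      rw [← hp₀]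
      exact (h.equiv_s m).symm q4
    have hb₀ : b₀ = b m (X m b₀ p₀) := by
      refine b_uniq m _ _ ((h.equiv_cs m).symm q8) ?_
      rw [← hc₀]
      exact q6
    simp only [← hp₀, ← hc₀, ← hb₀, q3, q5, q7]
  · intro m z
    simp only [p_e, c_e, b_e, cen_c, ps_p, pu_b]
  · intro m z h1 h2
    exact congrArg (fun w => (e m w).2.1) (cen_eq m z h1 h2)

end Decoupling

/-! ### Strong leaves and intersections of leaves -/

section Leaves

variable {M : Type*} {Z A B : M → Type*} [∀ m, MetricSpace (Z m)] [∀ m, MetricSpace (A m)]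
  [∀ m, MetricSpace (B m)]

namespace IsSplitting

/-- Rates at most `1` give the strong leaves, which therefore lie in leaves of rate at least `1`.
The floor `c / (K + 1)` keeps the rate positive where `ls` vanishes, as invariance of the leaves
requires, and is small enough not to leave the gap. -/
theorem exists_isGap_le_one {lu ls : M → ℝ≥0} {K : ℝ≥0} (hK : ∀ m, lu m ≤ K) (h1 : SupLtOne ls)
    (h2 : SupLtOne fun m => lu m * ls m) : ∃ ε, IsGap lu ls ε ∧ ∀ m, 0 < ε m ∧ ε m ≤ 1 := by
  obtain ⟨c₁, hc₁, h1⟩ := h1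
  obtain ⟨c₂, hc₂, h2⟩ := h2
  obtain ⟨c, hc0, hc⟩ := exists_between hc₂
  have hK1 : 0 < K + 1 := add_pos_of_nonneg_of_pos zero_le one_pos
  have hδ : 0 < c / (K + 1) := div_pos (zero_le.trans_lt hc0) hK1
  refine ⟨fun m => max (ls m) (c / (K + 1)), ⟨fun m => le_max_left _ _, c, hc, fun m => ?_⟩,
    fun m => ⟨lt_max_of_lt_right hδ, max_le ((h1 m).trans hc₁.le) ?_⟩⟩
  · change lu m * max (ls m) (c / (K + 1)) ≤ c
    rw [mul_max]
    refine max_le ((h2 m).trans hc0.le) ?_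
    rw [mul_div_assoc', div_le_iff₀ hK1, mul_comm]
    gcongr
    exact (hK m).trans le_self_add
  · rw [div_le_one₀ hK1]
    exact hc.le.trans le_add_self

variable {v : M → M} {e : ∀ m, Z m → Z (v m)} {σ : ∀ m, Z m ≃ A m × B m} {α lu β ls : M → ℝ≥0}
  [∀ m, CompleteSpace (A m)] [∀ m, CompleteSpace (B m)]

theorem existsUnique_asymp_fst (h : IsSplitting v e σ α lu β ls) {ε : M → ℝ≥0}
    (hε : IsGap lu ls ε) (m : M) (z : Z m) (a : A m) :
    ∃! w, Asymp v e ε m z w ∧ (σ m w).1 = a := by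
  obtain ⟨w, hw, hwa⟩ := h.exists_asymp hε m z a
  exact ⟨w, ⟨hw, hwa⟩, fun w' ⟨hw', hwa'⟩ =>
    h.eq_of_asymp hε (hw'.symm.trans hw) (hwa'.trans hwa.symm)⟩

/-- A stable leaf and an unstable leaf meet in exactly one point. -/
theorem existsUnique_asymp_inter {u : M ≃ M} {e : ∀ m, Z m ≃ Z (u m)}
    (h : IsSplitting u (fun m => e m) σ α lu β ls) {ε ε' : M → ℝ≥0} (hε : IsGap lu ls ε)
    (hε' : IsGap (fun m => ls (u.symm m)) (fun m => lu (u.symm m)) ε') (m : M) (z z' : Z m) :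
    ∃! w, Asymp u (fun m => e m) ε m z w ∧ Asymp u.symm (symmMap u e) ε' m z' w := by
  obtain ⟨θ, hθ, hα⟩ := h.angle
  have : Nonempty (B m) := ⟨(σ m z).2⟩
  refine existsUnique_mem_inter (σ m) (b := β m) (a := α (u.symm m)) ?_
    (h.exists_asymp hε m z) (h.symm.exists_asymp hε' m z')
    (fun p q hp hq => h.dist_snd_le hε (hp.symm.trans hq))
    (fun p q hp hq => h.symm.dist_snd_le hε' (hp.symm.trans hq))
  have := hα (u.symm m)
  dsimp only at this
  rw [u.apply_symm_apply, mul_comm] at this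
  exact this.trans_lt hθ

end IsSplitting

end Leaves

/-! ### The two splittings of a hyperbolic trichotomy -/

section Main

variable {M : Type*} {Xs Xc Xu : M → Type*}
  [∀ m, MetricSpace (Xs m)] [∀ m, MetricSpace (Xc m)] [∀ m, MetricSpace (Xu m)]
  {u : M ≃ M} {H : ∀ m, SetRel (Triple Xs Xc Xu m) (Triple Xs Xc Xu (u m))}
  {Fcs : ∀ m, Xs m × Xc m → Xu (u m) → Xs (u m) × Xc (u m)}
  {Gcs : ∀ m, Xs m × Xc m → Xu (u m) → Xu m}
  {Fcu : ∀ m, Xs m → Xc (u m) × Xu (u m) → Xs (u m)}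
  {Gcu : ∀ m, Xs m → Xc (u m) × Xu (u m) → Xc m × Xu m}
  {R : Rates M} {e : ∀ m, Triple Xs Xc Xu m ≃ Triple Xs Xc Xu (u m)}

/-- The splitting `X = X^{cs} × X^u`. -/
abbrev splitCS (Xs Xc Xu : M → Type*) (m : M) :
    Triple Xs Xc Xu m ≃ (fun m => Xs m × Xc m) m × Xu m :=
  (Equiv.prodAssoc (Xs m) (Xc m) (Xu m)).symm

/-- The splitting `X = X^s × X^{cu}`. -/
abbrev splitCU (Xs Xc Xu : M → Type*) (m : M) :
    Triple Xs Xc Xu m ≃ Xs m × (fun m => Xc m × Xu m) m :=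
  Equiv.refl _

namespace HyperbolicTrichotomy

theorem isSplitting_cs (h : HyperbolicTrichotomy u H Fcs Gcs Fcu Gcu R)
    (he : ∀ m z w, (z, w) ∈ H m ↔ e m z = w) :
    IsSplitting u (fun m => e m) (splitCS Xs Xc Xu) R.αu R.lamU R.βcs R.lamCS := by
  have hrel : ∀ m, splitRel u (fun m => e m) (splitCS Xs Xc Xu) m = regroupCS (H m) := fun m => by
    ext p
    exact (he m _ _).symm
  obtain ⟨K, hK⟩ := h.rates.bdd
  refine ⟨fun m z w => ?_, fun m => ⟨Fcs m, Gcs m, ?_⟩, fun m => ?_, ⟨K, fun m => ?_⟩,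
    h.rates.angle_u_cs, h.rates.αu_mono, h.rates.βcs_anti, h.rates.spectral_u_cs⟩
  · exact (max_assoc _ _ _).symm
  · rw [hrel]; exact h.gen_cs m
  · rw [hrel]; exact h.ab_cs m
  · exact ⟨(hK m).1, (hK m).2.1, (hK m).2.2.1, (hK m).2.2.2.1⟩

theorem isSplitting_cu (h : HyperbolicTrichotomy u H Fcs Gcs Fcu Gcu R)
    (he : ∀ m z w, (z, w) ∈ H m ↔ e m z = w) :
    IsSplitting u (fun m => e m) (splitCU Xs Xc Xu) R.αcu R.lamCU R.βs R.lamS := by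
  have hrel : ∀ m, splitRel u (fun m => e m) (splitCU Xs Xc Xu) m = H m := fun m => by
    ext p
    exact (he m _ _).symm
  obtain ⟨K, hK⟩ := h.rates.bdd
  refine ⟨fun m z w => rfl, fun m => ⟨Fcu m, Gcu m, ?_⟩, fun m => ?_, ⟨K, fun m => ?_⟩,
    h.rates.angle_cu_s, h.rates.αcu_mono, h.rates.βs_anti, h.rates.spectral_cu_s⟩
  · rw [hrel]; exact h.gen_cu m
  · rw [hrel]; exact h.ab_cu m
  · exact (hK m).2.2.2.2

theorem exists_isPseudoInvariant (h : HyperbolicTrichotomy u H Fcs Gcs Fcu Gcu R)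
    (he : ∀ m z w, (z, w) ∈ H m ↔ e m z = w) {i : ∀ m, Triple Xs Xc Xu m}
    (hi : IsPseudoInvariantSection (X := fun m => Xs m × Xc m) (Y := Xu) u Fcs Gcs
      (fun _ => 1) (fun m => ((i m).1, (i m).2.1)) (fun m => (i m).2.2)) :
    ∃ η, IsPseudoInvariant u (fun m => e m) i η ∧ ∀ m, η m ≤ η (u m) := by
  obtain ⟨η, h1, h2, h3, h4⟩ := hi
  simp only [one_mul] at h3 h4
  refine ⟨η, ⟨h3, fun m => ?_⟩, h4⟩
  set x := ((i m).1, (i m).2.1)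
  set y := (i (u m)).2.2
  -- By the generating map, this point is sent to `(Fcs m x y, y)`; it differs from `i m`, and its
  -- image from `i (u m)`, only by one of the two assumed errors.
  refine ⟨(x.1, x.2, Gcs m x y), ?_, ?_⟩
  · have h5 : dist (Gcs m x y) (i m).2.2 ≤ η m := by
      rw [dist_comm]
      exact h2 m
    exact max_le (by simp [x]) (max_le (by simp [x]) h5)
  · have hm := (h.gen_cs m x (Gcs m x y) (Fcs m x y) y).2 ⟨rfl, rfl⟩
    have hm' := (he m _ _).1 hm
    have h5 := h1 m
    rw [dist_comm] at h5
    have h6 : dist (e m (x.1, x.2, Gcs m x y)) (i (u m)) =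
        max (dist (Fcs m x y) ((i (u m)).1, (i (u m)).2.1)) (dist y (i (u m)).2.2) := by
      refine (congrArg (fun w => dist w (i (u m))) hm').trans ?_
      exact (max_assoc _ _ _).symm
    rw [h6, dist_self, max_eq_left dist_nonneg]
    exact h5.trans (mod_cast h3 m)

end HyperbolicTrichotomy

/-- The center-unstable leaves come from the inverse map, whose cone constant at `m` is `αcu` at
`u.symm m`. Monotonicity and the comparison of the constants reduce the product to the angle between
unstable and stable cones. -/
theorem Rates.Admissible.βcs_mul_αcu_lt_one (h : R.Admissible u) (m : M) :
    R.βcs m * R.αcu (u.symm m) < 1 := by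
  obtain ⟨θ, hθ, hle⟩ := h.angle_u_s
  have h1 : R.αcu (u.symm m) ≤ R.αu m := by
    have := h.αcu_mono (u.symm m)
    rw [u.apply_symm_apply] at this
    exact this.trans (h.αcu_le_αu m)
  calc R.βcs m * R.αcu (u.symm m) ≤ R.βs m * R.αu m := mul_le_mul' (h.βcs_le_βs m) h1
    _ = R.αu m * R.βs m := mul_comm _ _
    _ < 1 := (hle m).trans_lt hθ

end Main

end Trichotomy

/-! ### Assembly of the foliations and the center map -/

theorem corollary4p12 {M : Type*} {Xs Xc Xu : M → Type*}
    [∀ m, MetricSpace (Xs m)] [∀ m, MetricSpace (Xc m)] [∀ m, MetricSpace (Xu m)]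
    [∀ m, CompleteSpace (Xs m)] [∀ m, CompleteSpace (Xc m)] [∀ m, CompleteSpace (Xu m)]
    (u : M ≃ M)
    (H : ∀ m, SetRel (Trichotomy.Triple Xs Xc Xu m) (Trichotomy.Triple Xs Xc Xu (u m)))
    (Fcs : ∀ m, Xs m × Xc m → Xu (u m) → Xs (u m) × Xc (u m))
    (Gcs : ∀ m, Xs m × Xc m → Xu (u m) → Xu m)
    (Fcu : ∀ m, Xs m → Xc (u m) × Xu (u m) → Xs (u m))
    (Gcu : ∀ m, Xs m → Xc (u m) × Xu (u m) → Xc m × Xu m)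
    (R : Trichotomy.Rates M)
    (hHT : Trichotomy.HyperbolicTrichotomy u H Fcs Gcs Fcu Gcu R)
    (i : ∀ m, Trichotomy.Triple Xs Xc Xu m)
    (hi : Trichotomy.IsPseudoInvariantSection (X := fun m => Xs m × Xc m) (Y := Xu) u Fcs Gcs
      (fun _ => 1) (fun m => ((i m).1, (i m).2.1)) (fun m => (i m).2.2))
    (hinv : ∀ m, Trichotomy.IsInvertibleMap (H m)) :
    ∃ (hs : ∀ m, Xs m × Xc m → Xs (u m)) (hc : ∀ m, Xc m → Xc (u m))
      (hu : ∀ m, Xc m × Xu m → Xu (u m))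
      (P : ∀ m, Trichotomy.Triple Xs Xc Xu m → Trichotomy.Triple Xs Xc Xu m),
      (∀ m, Function.Bijective (P m)) ∧
      (∀ m, ∀ z w, (z, w) ∈ H m →
        P (u m) w =
          (hs m ((P m z).1, (P m z).2.1), hc m (P m z).2.1, hu m ((P m z).2.1, (P m z).2.2))) ∧
      (∀ m, Function.Bijective (hc m) ∧ LipschitzWith (R.lamCS m) (hc m) ∧
        AntilipschitzWith (R.lamCU m) (hc m)) ∧
      (∀ ε₁ ε₂ : M → ℝ≥0,
        Trichotomy.IsGrowthFunction R.lamCS R.lamU ε₁ →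
        Trichotomy.IsGrowthFunction R.lamCU R.lamS ε₂ →
        Trichotomy.RepresentsOnCenter u H (Trichotomy.centerSet u H i ε₁ ε₂) hc) := by
  open Trichotomy in
  choose e he using hinv
  have Scs := hHT.isSplitting_cs he
  have Scu := hHT.isSplitting_cu he
  have hR := hHT.rates
  obtain ⟨η, hη, hη'⟩ := hHT.exists_isPseudoInvariant he hi
  obtain ⟨K, hK⟩ := hR.bdd
  obtain ⟨ς₁, hς₁, gap₁⟩ := exists_isGap_minGrowth hR.spectral_u hR.spectral_u_cs
  have hsp₂ : SupLtOne fun m => R.lamS m * R.lamCU m := by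
    simpa only [mul_comm] using hR.spectral_cu_s
  have hsp₁ : SupLtOne fun m => R.lamCS m * R.lamU m := by
    simpa only [mul_comm] using hR.spectral_u_cs
  obtain ⟨ς₂, hς₂, gap₂⟩ := exists_isGap_minGrowth hR.spectral_s hsp₂
  obtain ⟨εs, gaps, hεs⟩ := IsSplitting.exists_isGap_le_one (fun m => (hK m).2.2.2.2.2.1)
    hR.spectral_s hR.spectral_cu_s
  obtain ⟨εu, gapu, hεu⟩ := IsSplitting.exists_isGap_le_one (fun m => (hK m).2.2.2.1)
    hR.spectral_u hsp₁
  have gcs := gap₁ ς₁ le_rfl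
  have gcu := (gap₂ ς₂ le_rfl).comp u.symm
  have gun := gapu.comp u.symm
  -- All admissible growth functions define the same sets, so one fixed choice serves for the whole
  -- proof.
  have fwd : ∀ ε₁, IsGrowthFunction R.lamCS R.lamU ε₁ → ∀ m,
      forwardSet u H i ε₁ m = growthSet u (fun m => e m) i (minGrowth R.lamCS ς₁) m :=
    fun ε₁ hε₁ m => by
      rw [forwardSet_eq_growthSet u e he]
      exact Scs.growthSet_eq_minGrowth hη hς₁ gap₁ hε₁ m
  have bwd : ∀ ε₂, IsGrowthFunction R.lamCU R.lamS ε₂ → ∀ m, backwardSet u H i ε₂ m =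
      growthSet u.symm (symmMap u e) i (fun m => minGrowth R.lamCU ς₂ (u.symm m)) m :=
    fun ε₂ hε₂ m => by
      rw [backwardSet_eq_growthSet u e he]
      exact Scu.symm.growthSet_eq_minGrowth_comp (fun m => (hK m).2.2.2.2.2.1) (hη.symm hη') hς₂
        gap₂ hε₂ m
  have pos₁ : ∀ m, 0 < minGrowth R.lamCS ς₁ m := fun m => one_pos.trans_le (one_le_minGrowth _ _ m)
  have pos₂ : ∀ m, 0 < minGrowth R.lamCU ς₂ (u.symm m) := fun m =>
    one_pos.trans_le (one_le_minGrowth _ _ _)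
  set Wcs := growthSet u (fun m => e m) i (minGrowth R.lamCS ς₁)
  set Wcu := growthSet u.symm (symmMap u e) i (fun m => minGrowth R.lamCU ς₂ (u.symm m))
  have ne₁ : ∀ m, (Wcs m).Nonempty := fun m => Scs.nonempty_growthSet hη hς₁ gcs m
  have ne₂ : ∀ m, (Wcu m).Nonempty := fun m =>
    Scu.symm.nonempty_growthSet (hη.symm hη') hς₂ gcu m
  have inv₁ : ∀ m z, z ∈ Wcs m ↔ e m z ∈ Wcs (u m) := fun m z => mem_growthSet_apply_iff pos₁
  have inv₂ : ∀ m z, z ∈ Wcu m ↔ e m z ∈ Wcu (u m) := mem_growthSet_symmMap_iff u e pos₂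
  have dist_cs : ∀ m z w, z ∈ Wcs m → w ∈ Wcs m →
      dist z.2.2 w.2.2 ≤ R.βcs m * dist (z.1, z.2.1) (w.1, w.2.1) := fun m z w hz hw =>
    Scs.dist_snd_le gcs (asymp_of_mem_growthSet hz hw)
  have dist_cu : ∀ m z w, z ∈ Wcu m → w ∈ Wcu m →
      dist z.1 w.1 ≤ R.αcu (u.symm m) * dist z.2 w.2 := fun m z w hz hw =>
    Scu.symm.dist_snd_le gcu (asymp_of_mem_growthSet hz hw)
  have center : ∀ m x, ∃! w, (w ∈ Wcs m ∧ w ∈ Wcu m) ∧ w.2.1 = x := by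
    intro m x
    obtain ⟨r₁, hr₁⟩ := ne₁ m
    obtain ⟨r₂, hr₂⟩ := ne₂ m
    have : Nonempty (Xs m) := ⟨r₁.1⟩
    refine existsUnique_mem_center (hR.αcu_le_one _) (hR.βcs_le_one m)
      (hR.βcs_mul_αcu_lt_one m) (fun a => ?_) (fun a => ?_) (dist_cs m) (dist_cu m) x
    · obtain ⟨w, hw, hwa⟩ := Scs.exists_asymp gcs m r₁ a
      exact ⟨w, (mem_growthSet_iff_asymp hr₁).2 hw, hwa⟩
    · obtain ⟨w, hw, hwa⟩ := Scu.symm.exists_asymp gcu m r₂ a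
      exact ⟨w, (mem_growthSet_iff_asymp hr₂).2 hw, hwa⟩
  have sys : FoliationSystem u (fun m => e m) (Asymp u (fun m => e m) (minGrowth R.lamCS ς₁))
      (Asymp u (fun m => e m) εs)
      (Asymp u.symm (symmMap u e) fun m => minGrowth R.lamCU ς₂ (u.symm m))
      (Asymp u.symm (symmMap u e) fun m => εu (u.symm m)) Wcs Wcu :=
    { equiv_cs := fun m => ⟨Asymp.refl, Asymp.symm, Asymp.trans⟩
      equiv_s := fun m => ⟨Asymp.refl, Asymp.symm, Asymp.trans⟩
      equiv_cu := fun m => ⟨Asymp.refl, Asymp.symm, Asymp.trans⟩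
      equiv_un := fun m => ⟨Asymp.refl, Asymp.symm, Asymp.trans⟩
      s_le_cs := fun m z w h => h.mono fun m => (hεs m).2.trans (one_le_minGrowth _ _ m)
      un_le_cu := fun m z w h => h.mono fun m => (hεu _).2.trans (one_le_minGrowth _ _ _)
      inv_cs := fun m z w => (Asymp.apply_iff pos₁).1
      inv_s := fun m z w => (Asymp.apply_iff fun m => (hεs m).1).1
      inv_un := fun m z w => (rel_apply_iff_of_symmMap u e
        (fun _ _ _ => Asymp.apply_iff fun m => (hεu (u.symm m)).1) m z w).1
      inv_Wcs := fun m z => (inv₁ m z).1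
      inv_Wcu := fun m z => (inv₂ m z).1
      Wcs_leaf := fun m z w hz => mem_growthSet_iff_asymp hz
      Wcu_leaf := fun m z w hz => mem_growthSet_iff_asymp hz
      cs_inter_un := Scs.existsUnique_asymp_inter gcs gun
      s_inter_cu := Scu.existsUnique_asymp_inter gaps gcu
      s_graph := Scu.existsUnique_asymp_fst gaps
      un_graph := Scs.symm.existsUnique_asymp_fst gun
      center_graph := center
      nonempty_Wcs := ne₁
      nonempty_Wcu := ne₂ }
  obtain ⟨hs, hc, hu, P, hP, hconj, hcen⟩ := sys.exists_decoupling
  have le_center : ∀ m z w, z ∈ Wcs m → z ∈ Wcu m → w ∈ Wcs m → w ∈ Wcu m →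
      dist z.1 w.1 ≤ dist z.2.1 w.2.1 ∧ dist z.2.2 w.2.2 ≤ dist z.2.1 w.2.1 :=
    fun m z w h1 h2 h3 h4 => dist_le_center (hR.αcu_le_one _) (hR.βcs_le_one m)
      (hR.βcs_mul_αcu_lt_one m) (dist_cs m z w h1 h3) (dist_cu m z w h2 h4)
  have lip : ∀ m, LipschitzWith (R.lamCS m) (hc m) := fun m =>
    LipschitzWith.of_dist_le_mul fun x y => by
      obtain ⟨z, ⟨⟨z1, z2⟩, rfl⟩, -⟩ := center m x
      obtain ⟨w, ⟨⟨w1, w2⟩, rfl⟩, -⟩ := center m y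
      rw [hcen m z z1 z2, hcen m w w1 w2]
      -- On the center set the center component carries the whole distance, so contraction of the
      -- center-stable component is a Lipschitz estimate for `hc`.
      have h1 := Scs.dist_fst_apply_le gcs (asymp_of_mem_growthSet z1 w1)
      have h2 : dist (splitCS Xs Xc Xu m z).1 (splitCS Xs Xc Xu m w).1 = dist z.2.1 w.2.1 :=
        max_eq_right (le_center m z w z1 z2 w1 w2).1
      rw [h2] at h1
      exact (le_max_right _ _).trans h1
  have anti : ∀ m, AntilipschitzWith (R.lamCU m) (hc m) := fun m =>
    AntilipschitzWith.of_le_mul_dist fun x y => by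
      obtain ⟨z, ⟨⟨z1, z2⟩, rfl⟩, -⟩ := center m x
      obtain ⟨w, ⟨⟨w1, w2⟩, rfl⟩, -⟩ := center m y
      rw [hcen m z z1 z2, hcen m w w1 w2]
      have z1' := (inv₁ m z).1 z1
      have w1' := (inv₁ m w).1 w1
      have z2' := (inv₂ m z).1 z2
      have w2' := (inv₂ m w).1 w2
      -- The same argument for the inverse map, whose contracted component is the center-unstable
      -- one.
      have h1 : dist (symmMap u e (u m) (e m z)).2 (symmMap u e (u m) (e m w)).2 ≤
          R.lamCU (u.symm (u m)) * dist (e m z).2 (e m w).2 :=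
        Scu.symm.dist_fst_apply_le gcu (asymp_of_mem_growthSet z2' w2')
      have h2 : dist (e m z).2 (e m w).2 = dist (e m z).2.1 (e m w).2.1 :=
        max_eq_left (le_center (u m) _ _ z1' z2' w1' w2').2
      rw [h2] at h1
      have key : ∀ n (_ : n = m) (a b : Triple Xs Xc Xu n), a ≍ z → b ≍ w →
          dist a.2 b.2 ≤ R.lamCU n * dist (e m z).2.1 (e m w).2.1 →
          dist z.2.1 w.2.1 ≤ R.lamCU m * dist (e m z).2.1 (e m w).2.1 := by
        rintro n rfl a b ha hb hle
        rw [eq_of_heq ha, eq_of_heq hb] at hle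
        exact (le_max_left _ _).trans hle
      exact key _ (u.symm_apply_apply m) _ _ (symmMap_apply_heq u e m z)
        (symmMap_apply_heq u e m w) h1
  refine ⟨hs, hc, hu, P, hP, fun m z w hzw => ?_, fun m => ⟨⟨(anti m).injective, fun x => ?_⟩,
    lip m, anti m⟩, fun ε₁ ε₂ hε₁ hε₂ => ⟨fun m => ?_, fun m z w hzw => ?_, fun m z w hzw hz => ?_⟩⟩
  · rw [← (he m _ _).1 hzw]
    exact hconj m z
  · obtain ⟨w, ⟨⟨w1, w2⟩, rfl⟩, -⟩ := center (u m) x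
    obtain ⟨z, rfl⟩ := (e m).surjective w
    exact ⟨z.2.1, hcen m z ((inv₁ m z).2 w1) ((inv₂ m z).2 w2)⟩
  · rw [centerSet, fwd ε₁ hε₁, bwd ε₂ hε₂]
    refine ⟨fun _ _ => Set.mem_univ _, fun z hz w hw hzw => ?_, fun x _ => ?_⟩
    · exact (center m w.2.1).unique ⟨hz, hzw⟩ ⟨hw, rfl⟩
    · obtain ⟨w, ⟨hw, hwx⟩, -⟩ := center m x
      exact ⟨w, hw, hwx⟩
  · rw [centerSet, centerSet, fwd ε₁ hε₁, bwd ε₂ hε₂, fwd ε₁ hε₁, bwd ε₂ hε₂,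
      ← (he m _ _).1 hzw]
    exact and_congr (inv₁ m z) (inv₂ m z)
  · rw [centerSet, fwd ε₁ hε₁, bwd ε₂ hε₂] at hz
    rw [← (he m _ _).1 hzw]
    exact (hcen m z hz.1 hz.2).symm
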